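/- All graphs are undirected and simple. Let $G=(V,E)$ be a connected, locally finite (possibly infinite) graph with at least two vertices, and let $d$ be its graph distance and $d_x$ the degree of a vertex $x$. For $0\le\alpha<1$ let $m_x^\alpha$ be the probability distribution on $V$ that gives mass $\alpha$ to $x$, mass $(1-\alpha)/d_x$ to each neighbour of $x$, and mass $0$ to every other vertex. For an edge $xy$ put $$\kappa_\alpha(x,y)=1-\frac{W(m_x^\alpha,m_y^\alpha)}{d(x,y)},\qquad \kappa(x,y)=\lim_{\alpha\to1^-}\frac{\kappa_\alpha(x,y)}{1-\alpha},$$ where $W(\mu,\nu)=\inf_A\sum_{u,v}A(u,v)\,d(u,v)$, the infimum being over all finitely supported couplings $A$ of $\mu$ and $\nu$. The graph $G$ is called Ricci-flat (in the sense of Lin, Lu and Yau) if $\kappa(x,y)=0$ for every edge $xy$. **Theorem.** Suppose that $G$ is Ricci-flat and has girth $g(G)\ge5$ (i.e. $G$ has no cycle of length $3$ or $4$; a graph without cycles has infinite girth). Then $G$ is isomorphic to one of the following graphs: 1. the infinite path, that is, the graph on $\mathbb Z$ in which consecutive integers are adjacent; 2. a cycle $C_n$ with $n\ge6$; 3. the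 dodecahedral graph; 4. the Petersen graph; 5. the half-dodecahedral graph, on the $15$ vertices $a_i,b_i,c_i$ ($i\in\mathbb Z/5$), with edges $a_ia_{i+1}$, $a_ib_i$, $b_ic_i$, $b_ic_{i+1}$; 6. the Triplex graph, that is, the cycle $1,2,\dots,12$ together with the chords $\{1,7\},\{2,10\},\{3,8\},\{4,12\},\{5,9\},\{6,11\}$. -/

import Mathlib

open Filter Topology

noncomputable section

namespace RicciFlat

variable {V : Type*}

/-- The finitely supported couplings of two distributions `μ`, `ν`: nonnegative weights on `V × V`
whose first marginal is `μ` and whose second marginal is `ν`. -/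
def IsCoupling (μ ν : V →₀ ℝ) (A : V × V →₀ ℝ) : Prop :=
  (∀ p, 0 ≤ A p) ∧ A.mapDomain Prod.fst = μ ∧ A.mapDomain Prod.snd = ν

/-- The transportation (Wasserstein) distance for the graph distance: the infimum of
`∑ A(u, v) d(u, v)` over all couplings `A`. -/
def transportDist (G : SimpleGraph V) (μ ν : V →₀ ℝ) : ℝ :=
  sInf {c : ℝ | ∃ A : V × V →₀ ℝ, IsCoupling μ ν A ∧
    c = A.sum fun p a => a * (G.dist p.1 p.2 : ℝ)}

/-- The `α`-lazy uniform random walk at `x`: mass `α` at `x` and mass `(1 - α) / d_x` at each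
neighbour of `x`. -/
def lazyWalk (G : SimpleGraph V) [G.LocallyFinite] (α : ℝ) (x : V) : V →₀ ℝ :=
  Finsupp.single x α + ∑ v ∈ G.neighborFinset x, Finsupp.single v ((1 - α) / (G.degree x : ℝ))

/-- The `α`-Ricci curvature `κ_α(x, y) = 1 - W(m_x^α, m_y^α) / d(x, y)`. -/
def alphaCurvature (G : SimpleGraph V) [G.LocallyFinite] (α : ℝ) (x y : V) : ℝ :=
  1 - transportDist G (lazyWalk G α x) (lazyWalk G α y) / (G.dist x y : ℝ)

/-- The Lin–Lu–Yau curvature `κ(x, y) = lim_{α → 1⁻} κ_α(x, y) / (1 - α)` exists and equals `k`. -/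
def HasRicciCurvature (G : SimpleGraph V) [G.LocallyFinite] (x y : V) (k : ℝ) : Prop :=
  Tendsto (fun α : ℝ => alphaCurvature G α x y / (1 - α)) (𝓝[<] 1) (𝓝 k)

/-- A graph is Ricci-flat if its Lin–Lu–Yau curvature is zero on every edge. -/
def IsRicciFlat (G : SimpleGraph V) [G.LocallyFinite] : Prop :=
  ∀ x y : V, G.Adj x y → HasRicciCurvature G x y 0

/-- The (two-way) infinite path: the integers, consecutive integers being adjacent. -/
def infinitePath : SimpleGraph ℤ :=
  SimpleGraph.fromRel fun a b => b = a + 1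

/-- The dodecahedral graph, drawn in four concentric levels of five vertices: an inner pentagon
(level 0), a 10-cycle alternating between levels 1 and 2, an outer pentagon (level 3), and spokes
joining level 0 to level 1 and level 2 to level 3. -/
def dodecahedralGraph : SimpleGraph (Fin 4 × ZMod 5) :=
  SimpleGraph.fromRel fun p q =>
    (p.1 = 0 ∧ q.1 = 0 ∧ q.2 = p.2 + 1) ∨
    (p.1 = 0 ∧ q.1 = 1 ∧ q.2 = p.2) ∨
    (p.1 = 1 ∧ q.1 = 2 ∧ (q.2 = p.2 ∨ q.2 = p.2 + 1)) ∨
    (p.1 = 2 ∧ q.1 = 3 ∧ q.2 = p.2) ∨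
    (p.1 = 3 ∧ q.1 = 3 ∧ q.2 = p.2 + 1)

/-- The Petersen graph: an outer pentagon (level 0), an inner pentagram (level 1), and spokes. -/
def petersenGraph : SimpleGraph (Fin 2 × ZMod 5) :=
  SimpleGraph.fromRel fun p q =>
    (p.1 = 0 ∧ q.1 = 0 ∧ q.2 = p.2 + 1) ∨
    (p.1 = 0 ∧ q.1 = 1 ∧ q.2 = p.2) ∨
    (p.1 = 1 ∧ q.1 = 1 ∧ q.2 = p.2 + 2)

/-- The half-dodecahedral graph: a pentagon (level 0) and a 10-cycle alternating between levels 1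
and 2, with spokes joining level 0 to level 1. -/
def halfDodecahedralGraph : SimpleGraph (Fin 3 × ZMod 5) :=
  SimpleGraph.fromRel fun p q =>
    (p.1 = 0 ∧ q.1 = 0 ∧ q.2 = p.2 + 1) ∨
    (p.1 = 0 ∧ q.1 = 1 ∧ q.2 = p.2) ∨
    (p.1 = 1 ∧ q.1 = 2 ∧ (q.2 = p.2 ∨ q.2 = p.2 + 1))

/-- The Triplex graph: a 12-cycle together with six chords. -/
def triplexGraph : SimpleGraph (ZMod 12) :=
  SimpleGraph.fromRel fun a b =>
    b = a + 1 ∨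
    (a = 1 ∧ b = 7) ∨ (a = 2 ∧ b = 10) ∨ (a = 3 ∧ b = 8) ∨
    (a = 4 ∧ b = 12) ∨ (a = 5 ∧ b = 9) ∨ (a = 6 ∧ b = 11)

end RicciFlat

end

/-! Girth at least 5 makes the geometry around an edge $xy$ simple: another neighbour $u$ of $x$ and
another neighbour $v$ of $y$ are at distance 2 or 3, and distance 2 means a common neighbour, that
is, a pentagon through $u,x,y,v$. So the sign of the curvature is governed by degrees and pentagons.

Dual potentials with small integer values (`curvature_bound`) show that nonnegative curvature forces
$1/d_x+2/d_y\ge1$, and that no such $u$ is at distance 3 from two different $v$. Explicit transport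
plans show that nonpositive curvature forbids leaves, and that an edge with $d_x=2$, $d_y\le3$ has a
pair $u,v$ at distance 3. These facts, with the absence of short cycles, are `IsLocallyFlat`;
nothing else about curvature is used afterwards.

The degree inequality leaves only degrees 2, 3 and 4. A 2-regular graph is a line or a cycle, and
the lengths 3, 4 and 5 are excluded by girth and by curvature. In all other cases the pentagon
conditions are so rigid that reconstructing $G$ breadth-first from one vertex or edge closes up
after finitely many choices. The search `explore` is run by the kernel three times: around a vertex
of degree 4 (no graph survives), around an edge with degrees 2 and 3 (only the half-dodecahedral
graph), and around a vertex of a cubic graph (Petersen, Triplex, dodecahedral).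

The search is sound because $G$ itself selects a branch: `Realizes` says that a coded partial graph
is a faithful picture of part of $G$, and each step extends the picture along a branch that passes
all tests (`Realizes.exists_leaf`). Running out of fuel or of the 32 places counts as failure, so a
successful search also proves that $G$ is finite; by connectedness its picture is then all of $G$.
-/

namespace RicciFlat

/-! ### Exploration of finite graphs

The functions below are evaluated by the kernel, so they are written with recursors and with the
arithmetic operations on natural numbers. A graph on at most 32 vertices is stored as a number:
bit `32 * i + j` says whether `i` and `j` are known to be adjacent. -/

/-- `List.all` by a recursor. -/
def allOf {α : Type} (p : α → Bool) (l : List α) : Bool :=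
  List.rec true (fun a _ ih => Bool.rec false ih (p a)) l

/-- `List.any` by a recursor. -/
def anyOf {α : Type} (p : α → Bool) (l : List α) : Bool :=
  List.rec false (fun a _ ih => Bool.rec ih true (p a)) l

/-- `List.filter` by a recursor. -/
def select {α : Type} (p : α → Bool) (l : List α) : List α :=
  List.rec [] (fun a _ ih => Bool.rec ih (a :: ih) (p a)) l

/-- `List.length` by a recursor. -/
def size {α : Type} (l : List α) : ℕ := List.rec 0 (fun _ _ ih => Nat.add ih 1) l

/-- `List.append` by a recursor. -/
def join {α : Type} (l m : List α) : List α := List.rec m (fun a _ ih => a :: ih) l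

/-- The list of the `m` numbers from `s` on. -/
def interval (s m : ℕ) : List ℕ :=
  Nat.rec (motive := fun _ => ℕ → List ℕ) (fun _ => []) (fun _ ih s => s :: ih (Nat.add s 1)) m s

/-- Evaluation of a number before it is substituted. -/
def force {β : Type} (n : ℕ) (c : ℕ → β) : β := Nat.rec (c 0) (fun m _ => c (Nat.succ m)) n

/-- Evaluation of a list of numbers before it is substituted. -/
def forceList {β : Type} (l : List ℕ) (c : List ℕ → β) : β :=
  List.rec (motive := fun _ => (List ℕ → β) → β) (fun c => c [])
    (fun a _ ih c => force a fun a => ih fun t => c (a :: t)) l c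

/-- The positions of the ones among the last `f` binary digits of `r`, shifted by `p`. -/
def bitsFrom (f : ℕ) : ℕ → ℕ → List ℕ :=
  Nat.rec (motive := fun _ => ℕ → ℕ → List ℕ) (fun _ _ => [])
    (fun _ ih p r => Bool.rec
      (force (Nat.shiftRight r 1) fun r' => force (Nat.add p 1) fun p' =>
        Bool.rec (ih p' r') (p :: ih p' r') (Nat.beq (Nat.land r 1) 1)) [] (Nat.beq r 0)) f

/-- The positions of the ones among the last 32 binary digits of `r`. -/
def bitList (r : ℕ) : List ℕ := bitsFrom 32 0 r

/-- Whether the binary digit `j` of `r` is one. -/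
def hasBit (r j : ℕ) : Bool := Nat.beq (Nat.land (Nat.shiftRight r j) 1) 1

/-- The neighbours of `i`, as a number. -/
def row (M i : ℕ) : ℕ := Nat.mod (Nat.shiftRight M (Nat.add 64 (Nat.mul 32 i))) 4294967296

/-- The list of neighbours of `i`. -/
def nbrs (M i : ℕ) : List ℕ := bitList (row M i)

/-- The graph `M` with edges from `k` to the vertices in the list. -/
def link (M k : ℕ) (l : List ℕ) : ℕ :=
  List.rec M (fun j _ ih => Nat.lor (Nat.lor ih (Nat.pow 2 (Nat.add 64 (Nat.add (Nat.mul 32 k) j))))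
    (Nat.pow 2 (Nat.add 64 (Nat.add (Nat.mul 32 j) k)))) l

/-- Replacement of the last 64 binary digits, which carry no information, by a check sum. -/
def rehash (M : ℕ) : ℕ :=
  Nat.add (Nat.shiftLeft (Nat.shiftRight M 64) 64) (Nat.mod M 18446744073709551557)

/-- The neighbours `N` of `k` create no triangle and no 4-cycle through `k` and a smaller vertex
opposite or adjacent to it. -/
def girthOK (M k N : ℕ) : Bool :=
  allOf (fun i => force (Nat.land (row M i) N) fun x =>
    -- A number `x` satisfies `x &&& (x - 1) = 0` exactly when it has at most one binary digit one;
    -- here this says that `i` and `k` share at most one neighbour.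
    Bool.rec (Bool.rec (Nat.beq (Nat.land x (Nat.sub x 1)) 0) false (hasBit (row M i) k)) true
      (Nat.beq x 0)) (interval 0 k)

/-- All extensions of the set `N` of neighbours of `k` by at most `r` of the given candidates. -/
def extensions (M k : ℕ) (c : List ℕ) : ℕ → ℕ → List ℕ :=
  List.rec (motive := fun _ => ℕ → ℕ → List ℕ) (fun _ N => [N])
    (fun j _ ih r N => Nat.rec [N] (fun r' _ => force (Nat.lor N (Nat.pow 2 j)) fun N' =>
      join (ih r N) (Bool.rec [] (ih r' N') (girthOK M k N'))) r) c

/-- Of two consecutive vertices with the same known neighbours, `N` contains the first if it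
contains the second. -/
def twinOK (M k n N : ℕ) : Bool :=
  allOf (fun j => Bool.rec (Bool.rec true (Bool.rec true false (Nat.beq (row M j) (row M (Nat.succ j))))
    (hasBit N (Nat.succ j))) true (hasBit N j)) (interval (Nat.succ k) (Nat.sub n (Nat.add k 2)))

/-- The possible sets of at most `D` neighbours of `k` among the vertices below `n`. -/
def oldNbrs (D M k n : ℕ) : List ℕ :=
  select (twinOK M k n)
    (extensions M k (interval (Nat.succ k) (Nat.sub n (Nat.succ k)))
      (Nat.sub D (size (nbrs M k))) (row M k))

/-- Whether the vertices with neighbours `a`, `b` may have a common neighbour if the vertices below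
`k` are explored; `p` and `q` say whether these vertices are explored. -/
def mayMeet (k a b : ℕ) (p q : Bool) : Bool :=
  Bool.rec true
    (Bool.rec (Bool.rec true (Bool.rec true false (Nat.beq (Nat.shiftRight b k) 0)) q)
      (Bool.rec (Bool.rec true false (Nat.beq (Nat.shiftRight a k) 0)) false q) p)
    (Nat.beq (Nat.land a b) 0)

/-- Whether `u` and `v` have no common neighbour if the vertices below `k` are explored. -/
def apart (M k u v : ℕ) : Bool :=
  Bool.rec true false (mayMeet k (row M u) (row M v) (Nat.blt u k) (Nat.blt v k))

/-- The flatness test for the edge `xy` if the vertices below `k` are explored. -/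
def edgeOK (M k x y : ℕ) : Bool :=
  forceList (nbrs M x) fun A => forceList (nbrs M y) fun B =>
  force (size A) fun a => force (size B) fun b =>
  forceList (select (fun u => Bool.rec true false (Nat.beq u y)) A) fun X =>
  forceList (select (fun v => Bool.rec true false (Nat.beq v x)) B) fun Y =>
    Bool.rec false
      (Bool.rec false
        (Bool.rec true
          (Bool.rec true (anyOf (fun u => anyOf (fun v => apart M k u v) Y) X)
            -- A pair without common neighbour is demanded only once all the vertices concerned are
            -- explored.
            (Bool.rec false (allOf (fun v => Nat.blt v k) Y) (allOf (fun u => Nat.blt u k) X)))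
          (Bool.rec false (Nat.ble b 3) (Nat.beq a 2)))
        (allOf (fun u => Nat.ble (size (select (apart M k u) Y)) 1) X))
      (Nat.ble (Nat.mul a b) (Nat.add (Nat.mul 2 a) b))

/-- The flatness test for the edges at the neighbours of `k`, the vertex explored last. -/
def flatOK (M k : ℕ) : Bool :=
  allOf (fun x => Bool.rec true
    (allOf (fun y => Bool.rec true (Bool.rec false (edgeOK M (Nat.succ k) y x)
      (edgeOK M (Nat.succ k) x y)) (Nat.ble y k)) (nbrs M x)) (Nat.ble x k)) (nbrs M k)

/-- Breadth-first exploration of the graphs with degrees in `degs`, at most `D`, that extend the graph `M`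
on `n` vertices, those below `k` being explored. It returns `true` if each finished graph passes the
test `leaf`. -/
def explore (D : ℕ) (degs : List ℕ) (leaf : ℕ → ℕ → Bool) (f : ℕ) : ℕ → ℕ → ℕ → Bool :=
  -- Lack of fuel is a failure, as is a graph with more than 32 vertices below; hence the value
  -- `true` certifies that the search was exhaustive.
  Nat.rec (motive := fun _ => ℕ → ℕ → ℕ → Bool) (fun _ _ _ => false)
    (fun _ ih k n M => Bool.rec
      (allOf (fun N => force (size (bitList N)) fun e => allOf (fun d => Bool.rec true
        (force (Nat.sub d e) fun m => force (Nat.add n m) fun n' =>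
          Bool.rec false
            (force (rehash (link M k (join (bitList N) (interval n m)))) fun M' =>
              Bool.rec true (force (Nat.succ k) fun k' => ih k' n' M') (flatOK M' k))
            (Nat.ble n' 32))
        (Nat.ble e d)) degs) (oldNbrs D M k n))
      (leaf n M) (Nat.beq k n)) f

/-- The graph with the given edges. -/
def ofEdges (l : List (ℕ × ℕ)) : ℕ := List.rec 0 (fun e _ ih => link ih e.1 [e.2]) l

/-- If the map that sends `0, …, m` to the members of the list `l`, read backwards, respects
adjacency, it still does so if `s` becomes the image of `m + 1`, where `R` and `S` are the
neighbours of `m + 1` and of `s`. -/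
def extendsIso (R S s : ℕ) (l : List ℕ) : ℕ → Bool :=
  List.rec (motive := fun _ => ℕ → Bool) (fun _ => true)
    (fun t _ ih m => Bool.rec (Bool.rec (Bool.rec (ih (Nat.sub m 1)) false (hasBit S t))
      (Bool.rec false (ih (Nat.sub m 1)) (hasBit S t)) (hasBit R m)) false (Nat.beq s t)) l

/-- The search for an isomorphism from the graph `M` on `n` vertices to the graph `T` that extends
the map given by the list `l`, read backwards. -/
def findIso (n M T f : ℕ) : ℕ → List ℕ → Bool :=
  Nat.rec (motive := fun _ => ℕ → List ℕ → Bool) (fun _ _ => true)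
    (fun _ ih m l => anyOf (fun s => Bool.rec false (force (Nat.succ m) fun m' => ih m' (s :: l))
      (extendsIso (row M m) (row T s) s l (Nat.sub m 1))) (interval 0 n)) f

/-- Whether the graph `M` on `n` vertices is isomorphic to the graph `T` on `n'` vertices. -/
def isIso (n' T n M : ℕ) : Bool := Bool.rec false (findIso n M T n 0 []) (Nat.beq n n')

/-! ### The target graphs and the three searches -/

/-- The edges of the dodecahedral graph. -/
def dodecahedralCode : ℕ := ofEdges
  [(0, 1), (1, 2), (2, 3), (3, 4), (4, 0), (0, 5), (1, 6), (2, 7), (3, 8), (4, 9),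
   (5, 10), (5, 11), (6, 11), (6, 12), (7, 12), (7, 13), (8, 13), (8, 14), (9, 14), (9, 10),
   (10, 15), (11, 16), (12, 17), (13, 18), (14, 19), (15, 16), (16, 17), (17, 18), (18, 19),
   (19, 15)]

/-- The edges of the Petersen graph. -/
def petersenCode : ℕ := ofEdges
  [(0, 1), (1, 2), (2, 3), (3, 4), (4, 0), (0, 5), (1, 6), (2, 7), (3, 8), (4, 9),
   (5, 7), (6, 8), (7, 9), (8, 5), (9, 6)]

/-- The edges of the half-dodecahedral graph. -/
def halfDodecahedralCode : ℕ := ofEdges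
  [(0, 1), (1, 2), (2, 3), (3, 4), (4, 0), (0, 5), (1, 6), (2, 7), (3, 8), (4, 9),
   (5, 10), (5, 11), (6, 11), (6, 12), (7, 12), (7, 13), (8, 13), (8, 14), (9, 14), (9, 10)]

/-- The edges of the Triplex graph. -/
def triplexCode : ℕ := ofEdges
  [(0, 1), (1, 2), (2, 3), (3, 4), (4, 5), (5, 6), (6, 7), (7, 8), (8, 9), (9, 10), (10, 11),
   (11, 0), (1, 7), (2, 10), (3, 8), (4, 0), (5, 9), (6, 11)]

/-- The start is the star of a vertex of degree 4. No leaf is accepted, so all branches die and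
degree 4 is impossible. -/
theorem explore_degree_four :
    explore 4 [2, 3, 4] (fun _ _ => false) 20 1 5 (link 0 0 [1, 2, 3, 4]) = true := by
  decide +kernel

/-- The start is an edge whose ends 0 and 1 have degrees 2 and 3, both already explored. -/
theorem explore_mixed :
    explore 3 [2, 3] (isIso 15 halfDodecahedralCode) 20 2 5 (link (link 0 0 [1, 2]) 1 [0, 3, 4]) =
      true := by
  decide +kernel

theorem explore_cubic :
    explore 3 [3] (fun n M => Bool.rec (Bool.rec (isIso 20 dodecahedralCode n M) true
      (isIso 12 triplexCode n M)) true (isIso 10 petersenCode n M)) 30 1 4 (link 0 0 [1, 2, 3]) =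
      true := by
  decide +kernel

/-! ### The recursor functions as ordinary list and bit operations -/

theorem rec_eq_cond {α : Type*} (x y : α) (b : Bool) :
    @Bool.rec (fun _ => α) x y b = cond b y x := by cases b <;> rfl

theorem allOf_eq_true {α : Type} {p : α → Bool} {l : List α} :
    allOf p l = true ↔ ∀ a ∈ l, p a = true := by
  induction l with
  | nil => simp [allOf]
  | cons a l ih =>
    rw [List.forall_mem_cons, ← ih]
    cases h : p a <;> simp [allOf, h]

theorem anyOf_eq_true {α : Type} {p : α → Bool} {l : List α} :
    anyOf p l = true ↔ ∃ a ∈ l, p a = true := by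
  induction l with
  | nil => simp [anyOf]
  | cons a l ih =>
    rw [List.exists_mem_cons_iff, ← ih]
    cases h : p a <;> simp [anyOf, h]

theorem select_eq_filter {α : Type} (p : α → Bool) (l : List α) : select p l = l.filter p := by
  induction l with
  | nil => simp [select]
  | cons a l ih =>
    rw [List.filter_cons, ← ih]
    cases h : p a <;> simp [select, h]

theorem size_eq_length {α : Type} (l : List α) : size l = l.length := by
  induction l with
  | nil => rfl
  | cons a l ih => rw [List.length_cons, ← ih]; rfl

theorem join_eq_append {α : Type} (l m : List α) : join l m = l ++ m := by
  induction l with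
  | nil => rfl
  | cons a l ih => rw [List.cons_append, ← ih]; rfl

theorem interval_eq_range' (s m : ℕ) : interval s m = List.range' s m := by
  induction m generalizing s with
  | zero => rfl
  | succ m ih => rw [List.range'_succ, ← ih]; rfl

theorem mem_interval {s m i : ℕ} : i ∈ interval s m ↔ s ≤ i ∧ i < s + m := by
  rw [interval_eq_range', List.mem_range'_1]

theorem force_eq {β : Type} (n : ℕ) (c : ℕ → β) : force n c = c n := by cases n <;> rfl

theorem forceList_eq {β : Type} (l : List ℕ) (c : List ℕ → β) : forceList l c = c l := by
  induction l generalizing c with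
  | nil => rfl
  | cons a l ih =>
    have : forceList (a :: l) c = force a fun a => forceList l fun t => c (a :: t) := rfl
    rw [this, force_eq, ih]

theorem beq_eq_decide (a b : ℕ) : Nat.beq a b = decide (a = b) := by
  rw [Bool.eq_iff_iff, decide_eq_true_iff, Nat.beq_eq]

theorem ble_eq_decide (a b : ℕ) : Nat.ble a b = decide (a ≤ b) := by
  rw [Bool.eq_iff_iff, decide_eq_true_iff, Nat.ble_eq]

theorem blt_eq_decide (a b : ℕ) : Nat.blt a b = decide (a < b) := ble_eq_decide _ _

theorem hasBit_eq_testBit (r j : ℕ) : hasBit r j = r.testBit j := by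
  have h : hasBit r j = Nat.beq (r >>> j &&& 1) 1 := rfl
  rw [h, Nat.testBit_eq_decide_div_mod_eq, Nat.and_one_is_mod, Nat.shiftRight_eq_div_pow,
    beq_eq_decide]

theorem bitsFrom_succ (f p r : ℕ) : bitsFrom (f + 1) p r =
    if r = 0 then [] else if r.testBit 0 then p :: bitsFrom f (p + 1) (r / 2)
      else bitsFrom f (p + 1) (r / 2) := by
  have : bitsFrom (f + 1) p r = Bool.rec
      (force (Nat.shiftRight r 1) fun r' => force (Nat.add p 1) fun p' =>
        Bool.rec (bitsFrom f p' r') (p :: bitsFrom f p' r') (hasBit r 0)) [] (Nat.beq r 0) := rfl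
  rw [this, rec_eq_cond, force_eq, force_eq, rec_eq_cond, hasBit_eq_testBit]
  have h2 : Nat.shiftRight r 1 = r / 2 := Nat.shiftRight_eq_div_pow r 1
  rw [h2]
  by_cases h : r = 0
  · simp [h]
  · have : Nat.beq r 0 = false := by rw [beq_eq_decide, decide_eq_false h]
    rw [this, if_neg h]
    cases r.testBit 0 <;> rfl

theorem mem_bitsFrom {f p r j : ℕ} :
    j ∈ bitsFrom f p r ↔ p ≤ j ∧ j < p + f ∧ r.testBit (j - p) = true := by
  induction f generalizing p r with
  | zero => simp [bitsFrom]; omega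
  | succ f ih =>
    rw [bitsFrom_succ]
    rcases lt_trichotomy j p with h | rfl | h
    · split_ifs <;> simp [ih] <;> omega
    · split_ifs with h1 h2
      · simp [h1]
      · simp [h2]
      · simp [ih, h2]
    · have e : r.testBit (j - p) = (r / 2).testBit (j - (p + 1)) := by
        rw [show j - p = j - (p + 1) + 1 by omega, Nat.testBit_succ]
      split_ifs with h1 h2
      · simp [h1]
      · rw [List.mem_cons, ih, e]; constructor
        · rintro (h' | h')
          · omega
          · exact ⟨by omega, by omega, h'.2.2⟩
        · rintro ⟨_, _, h'⟩; exact Or.inr ⟨by omega, by omega, h'⟩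
      · rw [ih, e]; constructor
        · rintro h'; exact ⟨by omega, by omega, h'.2.2⟩
        · rintro ⟨_, _, h'⟩; exact ⟨by omega, by omega, h'⟩

theorem nodup_bitsFrom (f p r : ℕ) : (bitsFrom f p r).Nodup := by
  induction f generalizing p r with
  | zero => exact List.nodup_nil
  | succ f ih =>
    rw [bitsFrom_succ]
    split_ifs
    · exact List.nodup_nil
    · refine List.nodup_cons.2 ⟨fun h => ?_, ih _ _⟩
      have := (mem_bitsFrom.1 h).1
      omega
    · exact ih _ _

theorem mem_bitList {r j : ℕ} : j ∈ bitList r ↔ j < 32 ∧ r.testBit j = true := by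
  simp [bitList, mem_bitsFrom]

theorem nodup_bitList (r : ℕ) : (bitList r).Nodup := nodup_bitsFrom _ _ _

/-- Adjacency of `i` and `j` in the graph `M`. -/
def Linked (M i j : ℕ) : Prop := M.testBit (64 + (32 * i + j)) = true

theorem testBit_row {M i j : ℕ} : (row M i).testBit j = true ↔ j < 32 ∧ Linked M i j := by
  have h : row M i = (M >>> (64 + 32 * i)) % 2 ^ 32 := rfl
  rw [h, Nat.testBit_mod_two_pow, Nat.testBit_shiftRight, Linked, Bool.and_eq_true,
    decide_eq_true_iff, add_assoc]

theorem mem_nbrs {M i j : ℕ} : j ∈ nbrs M i ↔ j < 32 ∧ Linked M i j := by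
  rw [nbrs, mem_bitList, testBit_row]; tauto

theorem nodup_nbrs (M i : ℕ) : (nbrs M i).Nodup := nodup_bitList _

theorem linked_link {M k : ℕ} (hk : k < 32) {l : List ℕ} (hl : ∀ j ∈ l, j < 32) {i j : ℕ}
    (hj : j < 32) :
    Linked (link M k l) i j ↔ Linked M i j ∨ (i = k ∧ j ∈ l) ∨ (j = k ∧ i ∈ l) := by
  induction l with
  | nil => simp [link]
  | cons a l ih =>
    have e : link M k (a :: l) = Nat.lor (Nat.lor (link M k l)
      (Nat.pow 2 (Nat.add 64 (Nat.add (Nat.mul 32 k) a))))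
      (Nat.pow 2 (Nat.add 64 (Nat.add (Nat.mul 32 a) k))) := rfl
    replace e : link M k (a :: l) =
      (link M k l ||| 2 ^ (64 + (32 * k + a))) ||| 2 ^ (64 + (32 * a + k)) := e
    have ha := hl a (by simp)
    rw [e, Linked, Nat.testBit_or, Nat.testBit_or, Bool.or_eq_true, Bool.or_eq_true,
      Nat.testBit_two_pow, Nat.testBit_two_pow, decide_eq_true_iff, decide_eq_true_iff]
    change (Linked (link M k l) i j ∨ _) ∨ _ ↔ _
    rw [ih fun j hj => hl j (by simp [hj]), List.mem_cons, List.mem_cons]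
    clear e ih
    have e1 : 64 + (32 * k + a) = 64 + (32 * i + j) ↔ i = k ∧ j = a := by omega
    have e2 : 64 + (32 * a + k) = 64 + (32 * i + j) ↔ j = k ∧ i = a := by omega
    rw [e1, e2]; tauto

/-- Adjacency is stored from digit 64 on, so any check sum below `2 ^ 64` leaves it intact. -/
theorem linked_rehash {M i j : ℕ} : Linked (rehash M) i j ↔ Linked M i j := by
  have h (a p : ℕ) (hp : p < 2 ^ 64) (h0 : 0 < p) :
      Nat.add (Nat.shiftLeft (Nat.shiftRight a 64) 64) (Nat.mod a p) >>> 64 = a >>> 64 := by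
    change ((a >>> 64) <<< 64 + a % p) >>> 64 = a >>> 64
    have := Nat.mod_lt a h0
    rw [Nat.shiftLeft_eq, Nat.shiftRight_eq_div_pow _ 64, mul_comm,
      Nat.mul_add_div (by norm_num), Nat.div_eq_of_lt (by omega), add_zero]
  rw [Linked, Linked, ← Nat.testBit_shiftRight, rehash, h _ _ (by norm_num) (by norm_num),
    Nat.testBit_shiftRight]

theorem land_eq_zero {a b : ℕ} :
    Nat.land a b = 0 ↔ ∀ j, ¬(a.testBit j = true ∧ b.testBit j = true) := by
  change a &&& b = 0 ↔ _
  constructor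
  · intro h j hj
    have : (a &&& b).testBit j = true := by rw [Nat.testBit_and, hj.1, hj.2]; rfl
    rw [h] at this; simp at this
  · intro h
    refine Nat.eq_of_testBit_eq fun j => ?_
    rw [Nat.testBit_and, Nat.zero_testBit, Bool.eq_false_iff]
    exact fun h' => h j (by simpa using h')

theorem land_sub_one_eq_zero {x : ℕ}
    (h : ∀ i j, x.testBit i = true → x.testBit j = true → i = j) :
    Nat.land x (x - 1) = 0 := by
  change x &&& (x - 1) = 0
  rcases Nat.eq_zero_or_pos x with rfl | hx
  · rfl
  · obtain ⟨i, hi⟩ := Nat.exists_testBit_of_ne_zero hx.ne'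
    have : x = 2 ^ i := Nat.eq_of_testBit_eq fun j => by
      rw [Nat.testBit_two_pow]
      by_cases e : i = j
      · subst e; simp [hi]
      · rw [decide_eq_false e, Bool.eq_false_iff]; exact fun h' => e (h _ _ hi h')
    rw [this, Nat.and_two_pow_sub_one_eq_mod, Nat.mod_self]

/-! ### Local flatness, and the tests passed by pictures of a locally flat graph -/

section

/-- The consequences of Ricci-flatness and of girth at least five that determine the graph. -/
structure IsLocallyFlat {V : Type*} (G : SimpleGraph V) [G.LocallyFinite] : Prop where
  not_triangle : ∀ u v w, G.Adj u v → G.Adj v w → ¬G.Adj u w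
  not_square : ∀ u v w z, G.Adj u w → G.Adj v w → G.Adj u z → G.Adj v z → u ≠ v → w = z
  -- Equivalently $1/d_x+2/d_y\ge1$; the inequality is not symmetric and is used for both
  -- orientations of an edge.
  degree_mul_le : ∀ x y, G.Adj x y → G.degree x * G.degree y ≤ 2 * G.degree x + G.degree y
  -- Among any two other neighbours of `y`, one completes a pentagon with `u`, `x`, `y`.
  meet : ∀ x y u v w, G.Adj x y → G.Adj x u → u ≠ y → G.Adj y v → v ≠ x → G.Adj y w → w ≠ x →
    v ≠ w → (∃ z, G.Adj u z ∧ G.Adj v z) ∨ ∃ z, G.Adj u z ∧ G.Adj w z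
  two_le_degree : ∀ x, 2 ≤ G.degree x
  apart : ∀ x y, G.Adj x y → G.degree x = 2 → G.degree y ≤ 3 →
    ∃ u v, G.Adj x u ∧ u ≠ y ∧ G.Adj y v ∧ v ≠ x ∧ ¬∃ z, G.Adj u z ∧ G.Adj v z

variable {V : Type*} {G : SimpleGraph V}

/-- The map `φ` identifies the graph `M` on `n` vertices with the graph of all edges of `G` among
`φ 0, …, φ (n - 1)` that have an end among `φ 0, …, φ (k - 1)`, and all neighbours of the latter
vertices occur. -/
structure Realizes (G : SimpleGraph V) (k n M : ℕ) (φ : ℕ → V) : Prop where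
  le : k ≤ n
  le_bound : n ≤ 32
  inj : ∀ i < n, ∀ j < n, φ i = φ j → i = j
  linked_iff : ∀ i < 32, ∀ j < 32,
    Linked M i j ↔ i < n ∧ j < n ∧ (i < k ∨ j < k) ∧ G.Adj (φ i) (φ j)
  closed : ∀ i < k, ∀ v, G.Adj (φ i) v → ∃ j < n, φ j = v

namespace Realizes

variable {k n M : ℕ} {φ : ℕ → V}

theorem mem_nbrs_iff (h : Realizes G k n M φ) {i j : ℕ} (hi : i < 32) :
    j ∈ nbrs M i ↔ i < n ∧ j < n ∧ (i < k ∨ j < k) ∧ G.Adj (φ i) (φ j) := by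
  have := h.le_bound
  rw [mem_nbrs]
  constructor
  · rintro ⟨hj, hl⟩; exact (h.linked_iff i hi j hj).1 hl
  · rintro hl; exact ⟨by omega, (h.linked_iff i hi j (by omega)).2 hl⟩

theorem mem_nbrs_iff' (h : Realizes G k n M φ) {i j : ℕ} (hi : i < k) :
    j ∈ nbrs M i ↔ j < n ∧ G.Adj (φ i) (φ j) := by
  have := h.le; have := h.le_bound
  rw [h.mem_nbrs_iff (by omega)]
  simp [hi, show i < n by omega]

theorem row_iff (h : Realizes G k n M φ) {i j : ℕ} (hi : i < 32) :
    (row M i).testBit j = true ↔ i < n ∧ j < n ∧ (i < k ∨ j < k) ∧ G.Adj (φ i) (φ j) := by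
  rw [testBit_row, ← mem_nbrs, h.mem_nbrs_iff hi]

theorem length_nbrs [G.LocallyFinite] (h : Realizes G k n M φ) {i : ℕ} (hi : i < k) :
    (nbrs M i).length = G.degree (φ i) := by
  classical
  rw [← List.toFinset_card_of_nodup (nodup_nbrs M i), ← SimpleGraph.card_neighborFinset_eq_degree]
  refine Finset.card_bij (fun j _ => φ j) ?_ ?_ ?_
  · intro j hj
    rw [SimpleGraph.mem_neighborFinset]
    exact ((h.mem_nbrs_iff' hi).1 (List.mem_toFinset.1 hj)).2
  · intro a ha b hb e
    exact h.inj a ((h.mem_nbrs_iff' hi).1 (List.mem_toFinset.1 ha)).1 b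
      ((h.mem_nbrs_iff' hi).1 (List.mem_toFinset.1 hb)).1 e
  · intro v hv
    rw [SimpleGraph.mem_neighborFinset] at hv
    obtain ⟨j, hj, rfl⟩ := h.closed i hi v hv
    exact ⟨j, List.mem_toFinset.2 ((h.mem_nbrs_iff' hi).2 ⟨hj, hv⟩), rfl⟩

/-- The certificate `apart` never errs: a common neighbour missing from the picture must be
unexplored, neither vertex has all its adjacencies to it recorded unless it is explored, and two
explored vertices would both show it. -/
theorem mayMeet_of_meet (h : Realizes G k n M φ) {u v : ℕ} (hu : u < n) (hv : v < n)
    (hm : ∃ z, G.Adj (φ u) z ∧ G.Adj (φ v) z) : apart M k u v = false := by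
  have hn := h.le_bound
  have key : mayMeet k (row M u) (row M v) (Nat.blt u k) (Nat.blt v k) = true := by
    simp only [mayMeet, rec_eq_cond, blt_eq_decide, beq_eq_decide]
    by_contra hc
    by_cases h0 : Nat.land (row M u) (row M v) = 0
    swap
    · rw [decide_eq_false h0] at hc; exact hc rfl
    obtain ⟨z, hz, hz'⟩ := hm
    rw [land_eq_zero] at h0
    have key : ∀ a b : ℕ, a < n → b < n → a < k → G.Adj (φ a) z → G.Adj (φ b) z →
        (∀ j, ¬((row M a).testBit j = true ∧ (row M b).testBit j = true)) →
        ¬b < k ∧ Nat.shiftRight (row M a) k ≠ 0 := by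
      intro a b ha hb hak haz hbz h0
      obtain ⟨j, hj, rfl⟩ := h.closed a hak z haz
      have h1 : (row M a).testBit j = true :=
        (h.row_iff (by omega)).2 ⟨ha, hj, Or.inl hak, haz⟩
      have h2 : ¬(b < k ∨ j < k) := fun hbk =>
        h0 j ⟨h1, (h.row_iff (by omega)).2 ⟨hb, hj, hbk, hbz⟩⟩
      refine ⟨fun hb => h2 (Or.inl hb), fun hs => ?_⟩
      have : (row M a >>> k).testBit (j - k) = true := by
        rw [Nat.testBit_shiftRight, Nat.add_sub_cancel' (by omega)]; exact h1
      rw [show row M a >>> k = 0 from hs] at this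
      simp at this
    by_cases hu' : u < k
    · obtain ⟨h1, h2⟩ := key u v hu hv hu' hz hz' h0
      rw [decide_eq_true hu', decide_eq_false h1, decide_eq_false h2] at hc
      cases e : decide (Nat.land (row M u) (row M v) = 0) <;> rw [e] at hc <;> exact hc rfl
    · by_cases hv' : v < k
      · obtain ⟨h1, h2⟩ := key v u hv hu hv' hz' hz fun j hj => h0 j hj.symm
        rw [decide_eq_false hu', decide_eq_true hv', decide_eq_false h2] at hc
        cases e : decide (Nat.land (row M u) (row M v) = 0) <;> rw [e] at hc <;> exact hc rfl
      · simp [hu', hv'] at hc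
  rw [RicciFlat.apart, key]

/-- The tests of `edgeOK` are `degree_mul_le`, `meet` and `apart` read in the picture. For `meet` it
is enough that `apart` is never wrongly true; for the last test the relevant vertices are explored,
so their rows are complete and `apart` is exact. -/
theorem edgeOK_eq_true [G.LocallyFinite] (hG : IsLocallyFlat G) (h : Realizes G k n M φ) {x y : ℕ}
    (hx : x < k) (hy : y < k) (hxy : G.Adj (φ x) (φ y)) : edgeOK M k x y = true := by
  have hkn := h.le
  have hX : ∀ u, (u ∈ (nbrs M x).filter fun u => cond (Nat.beq u y) false true) ↔
      u < n ∧ G.Adj (φ x) (φ u) ∧ u ≠ y := by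
    intro u
    rw [List.mem_filter, h.mem_nbrs_iff' hx, beq_eq_decide]
    by_cases e : u = y <;> simp [e]
  have hY : ∀ v, (v ∈ (nbrs M y).filter fun v => cond (Nat.beq v x) false true) ↔
      v < n ∧ G.Adj (φ y) (φ v) ∧ v ≠ x := by
    intro v
    rw [List.mem_filter, h.mem_nbrs_iff' hy, beq_eq_decide]
    by_cases e : v = x <;> simp [e]
  simp only [edgeOK, forceList_eq, force_eq, rec_eq_cond, select_eq_filter, size_eq_length,
    h.length_nbrs hx, h.length_nbrs hy]
  have h1 : Nat.ble (Nat.mul (G.degree (φ x)) (G.degree (φ y)))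
      (Nat.add (Nat.mul 2 (G.degree (φ x))) (G.degree (φ y))) = true :=
    Nat.ble_eq.mpr (hG.degree_mul_le _ _ hxy)
  rw [h1, cond_true]
  have hYn : ((nbrs M y).filter fun v => cond (Nat.beq v x) false true).Nodup :=
    (nodup_nbrs M y).filter _
  revert hX hY hYn
  generalize (nbrs M x).filter _ = X
  generalize (nbrs M y).filter _ = Y
  intro hX hY hYn
  have h2 : allOf (fun u => Nat.ble (Y.filter (RicciFlat.apart M k u)).length 1) X = true := by
    refine allOf_eq_true.2 fun u hu => Nat.ble_eq.mpr ?_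
    obtain ⟨hu, hxu, huy⟩ := (hX u).1 hu
    rw [← List.toFinset_card_of_nodup (hYn.filter _), Finset.card_le_one]
    intro v hv w hw
    rw [List.mem_toFinset, List.mem_filter, hY] at hv hw
    by_contra hvw
    have ne : ∀ a b, a < n → b < n → a ≠ b → φ a ≠ φ b := fun a b ha hb hab e =>
      hab (h.inj a ha b hb e)
    rcases hG.meet (φ x) (φ y) (φ u) (φ v) (φ w) hxy hxu (ne _ _ hu (by omega) huy) hv.1.2.1
      (ne _ _ hv.1.1 (by omega) hv.1.2.2) hw.1.2.1 (ne _ _ hw.1.1 (by omega) hw.1.2.2)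
      (ne _ _ hv.1.1 hw.1.1 hvw) with hm | hm
    · have := h.mayMeet_of_meet hu hv.1.1 hm
      rw [hv.2] at this; cases this
    · have := h.mayMeet_of_meet hu hw.1.1 hm
      rw [hw.2] at this; cases this
  rw [h2, cond_true]
  cases h3 : cond (Nat.beq (G.degree (φ x)) 2) (Nat.ble (G.degree (φ y)) 3) false
  · rfl
  cases h4 : cond (allOf (fun u => Nat.blt u k) X) (allOf (fun v => Nat.blt v k) Y) false
  · rfl
  rw [cond_true, cond_true]
  have h3' : G.degree (φ x) = 2 ∧ G.degree (φ y) ≤ 3 := by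
    rw [beq_eq_decide, ble_eq_decide] at h3
    by_cases e : G.degree (φ x) = 2 <;> simp_all
  have h4' : (∀ u ∈ X, u < k) ∧ ∀ v ∈ Y, v < k := by
    cases e : allOf (fun u => Nat.blt u k) X
    · rw [e] at h4; cases h4
    · rw [e, cond_true, allOf_eq_true] at h4
      rw [allOf_eq_true] at e
      exact ⟨fun u hu => by simpa [blt_eq_decide] using e u hu,
        fun v hv => by simpa [blt_eq_decide] using h4 v hv⟩
  obtain ⟨u', v', hu, huy, hv, hvx, hm⟩ := hG.apart _ _ hxy h3'.1 h3'.2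
  obtain ⟨u, hun, rfl⟩ := h.closed x hx u' hu
  obtain ⟨v, hvn, rfl⟩ := h.closed y hy v' hv
  have huX : u ∈ X := (hX u).2 ⟨hun, hu, fun e => huy (e ▸ rfl)⟩
  have hvY : v ∈ Y := (hY v).2 ⟨hvn, hv, fun e => hvx (e ▸ rfl)⟩
  refine anyOf_eq_true.2 ⟨u, huX, anyOf_eq_true.2 ⟨v, hvY, ?_⟩⟩
  have huk := h4'.1 u huX
  have hvk := h4'.2 v hvY
  have hn := h.le_bound
  have h0 : Nat.land (row M u) (row M v) = 0 := by
    rw [land_eq_zero]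
    rintro j ⟨h1, h2⟩
    rw [h.row_iff (by omega)] at h1 h2
    exact hm ⟨φ j, h1.2.2.2, h2.2.2.2⟩
  rw [RicciFlat.apart, mayMeet, h0, blt_eq_decide, blt_eq_decide, decide_eq_true huk,
    decide_eq_true hvk]
  rfl

theorem flatOK_eq_true [G.LocallyFinite] (hG : IsLocallyFlat G)
    (h : Realizes G (k + 1) n M φ) : flatOK M k = true := by
  have hkn := h.le
  have hn := h.le_bound
  simp only [flatOK, rec_eq_cond]
  refine allOf_eq_true.2 fun x hx => ?_
  rw [ble_eq_decide]
  by_cases hxk : x ≤ k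
  swap
  · simp [hxk]
  rw [decide_eq_true hxk, cond_true]
  refine allOf_eq_true.2 fun y hy => ?_
  rw [ble_eq_decide]
  by_cases hyk : y ≤ k
  swap
  · simp [hyk]
  have hxy := ((h.mem_nbrs_iff' (by omega)).1 hy).2
  rw [decide_eq_true hyk, h.edgeOK_eq_true hG (by omega) (by omega) hxy,
    h.edgeOK_eq_true hG (by omega) (by omega) hxy.symm]
  rfl

/-- The set `N` may be any part of the neighbourhood of `φ k`, since the search tests incomplete
neighbourhoods as it builds them. -/
theorem girthOK_eq_true [G.LocallyFinite] (hG : IsLocallyFlat G) (h : Realizes G k n M φ)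
    (hk : k < n) {N : ℕ} (hN : ∀ j, N.testBit j = true → j < n ∧ G.Adj (φ k) (φ j)) :
    girthOK M k N = true := by
  have hn := h.le_bound
  simp only [girthOK, rec_eq_cond, force_eq]
  refine allOf_eq_true.2 fun i hi => ?_
  have hik : i < k := by rw [mem_interval] at hi; omega
  have hb : ∀ j, (Nat.land (row M i) N).testBit j = true →
      j < n ∧ G.Adj (φ i) (φ j) ∧ G.Adj (φ k) (φ j) := by
    intro j hj
    have : ((row M i) &&& N).testBit j = true := hj
    rw [Nat.testBit_and, Bool.and_eq_true, h.row_iff (by omega)] at this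
    exact ⟨this.1.2.1, this.1.2.2.2, (hN j this.2).2⟩
  have h1 : Nat.land (Nat.land (row M i) N) (Nat.sub (Nat.land (row M i) N) 1) = 0 :=
    land_sub_one_eq_zero fun a b ha hb' => by
      obtain ⟨ha, ha1, ha2⟩ := hb a ha
      obtain ⟨hb, hb1, hb2⟩ := hb b hb'
      refine h.inj a ha b hb (hG.not_square _ _ _ _ ha1 ha2 hb1 hb2 fun e => ?_)
      have := h.inj i (by omega) k hk e
      omega
  rw [h1]
  by_cases h0 : Nat.land (row M i) N = 0
  · rw [h0]; rfl
  · have h2 : hasBit (row M i) k = false := by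
      rw [hasBit_eq_testBit, Bool.eq_false_iff]
      intro h3
      rw [h.row_iff (by omega)] at h3
      obtain ⟨j, hj⟩ := Nat.exists_testBit_of_ne_zero h0
      obtain ⟨_, hj1, hj2⟩ := hb j hj
      exact hG.not_triangle _ _ _ h3.2.2.2 hj2 hj1
    rw [h2]
    cases (Nat.land (row M i) N).beq 0 <;> rfl

end Realizes

end

/-! ### Soundness of the search -/

section

variable {V : Type*} {G : SimpleGraph V}

/-- Pruning by girth loses nothing: the true set of neighbours is built by adding one element at a
time, and `hg` lets every intermediate set pass the test. -/
theorem exists_mem_extensions (M k : ℕ) (P : ℕ → Prop) [DecidablePred P] (c : List ℕ) (r N : ℕ)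
    (hr : (c.filter P).length ≤ r)
    (hg : ∀ N', (∀ j, N'.testBit j = true → N.testBit j = true ∨ P j) → girthOK M k N' = true) :
    ∃ N' ∈ extensions M k c r N,
      ∀ j, N'.testBit j = true ↔ N.testBit j = true ∨ (j ∈ c ∧ P j) := by
  induction c generalizing r N with
  | nil => exact ⟨N, by simp [extensions], by simp⟩
  | cons a c ih =>
    have e : ∀ r', extensions M k (a :: c) (r' + 1) N = extensions M k c (r' + 1) N ++
        cond (girthOK M k (N ||| 2 ^ a)) (extensions M k c r' (N ||| 2 ^ a)) [] := by
      intro r'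
      rw [← rec_eq_cond, ← join_eq_append,
        ← force_eq (N ||| 2 ^ a) fun N' => join (extensions M k c (r' + 1) N)
          (Bool.rec [] (extensions M k c r' N') (girthOK M k N'))]
      rfl
    have hb : ∀ j, (N ||| 2 ^ a).testBit j = true ↔ N.testBit j = true ∨ j = a := by
      intro j
      rw [Nat.testBit_or, Nat.testBit_two_pow, Bool.or_eq_true, decide_eq_true_iff, eq_comm (a := a)]
    by_cases ha : P a
    · rw [List.filter_cons_of_pos (by simpa using ha), List.length_cons] at hr
      obtain ⟨r', rfl⟩ : ∃ r', r = r' + 1 := ⟨r - 1, by omega⟩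
      obtain ⟨N', hN', h⟩ := ih r' (N ||| 2 ^ a) (by omega) fun N' h => hg N' fun j hj => by
        rcases h j hj with h | h
        · rcases (hb j).1 h with h | rfl
          · exact Or.inl h
          · exact Or.inr ha
        · exact Or.inr h
      refine ⟨N', ?_, fun j => ?_⟩
      · rw [e, hg _ fun j hj => ((hb j).1 hj).imp_right fun h => by rwa [h], cond_true]
        exact List.mem_append_right _ hN'
      · rw [h, hb, List.mem_cons]
        constructor
        · rintro ((h | rfl) | h)
          · exact Or.inl h
          · exact Or.inr ⟨Or.inl rfl, ha⟩
          · exact Or.inr ⟨Or.inr h.1, h.2⟩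
        · rintro (h | ⟨rfl | h, h'⟩)
          · exact Or.inl (Or.inl h)
          · exact Or.inl (Or.inr rfl)
          · exact Or.inr ⟨h, h'⟩
    · rw [List.filter_cons_of_neg (by simpa using ha)] at hr
      have hc : ∀ j, j ∈ a :: c ∧ P j ↔ j ∈ c ∧ P j := by
        intro j
        rw [List.mem_cons]
        constructor
        · rintro ⟨rfl | h, h'⟩
          · exact absurd h' ha
          · exact ⟨h, h'⟩
        · exact fun h => ⟨Or.inr h.1, h.2⟩
      obtain ⟨N', hN', h⟩ := ih r N hr hg
      cases r with
      | zero =>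
        refine ⟨N, by simp [extensions], fun j => ⟨Or.inl, ?_⟩⟩
        rw [hc]
        rintro (h | ⟨h, h'⟩)
        · exact h
        · have := List.length_pos_of_mem (List.mem_filter (p := fun b => decide (P b)).2 ⟨h, decide_eq_true h'⟩)
          omega
      | succ r =>
        exact ⟨N', by rw [e]; exact List.mem_append_left _ hN', fun j => by rw [h, hc]⟩

namespace Realizes

variable {k n M : ℕ} {φ : ℕ → V}

theorem rehash (h : Realizes G k n M φ) : Realizes G k n (rehash M) φ :=
  ⟨h.le, h.le_bound, h.inj, fun i hi j hj => linked_rehash.trans (h.linked_iff i hi j hj), h.closed⟩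

/-- Two unexplored vertices with equal rows are indistinguishable in the picture, so their names can
be exchanged. This justifies the symmetry reduction `twinOK`. -/
theorem comp_swap (h : Realizes G k n M φ) {a b : ℕ} (ha : k ≤ a) (hb : k ≤ b) (han : a < n)
    (hbn : b < n) (hab : row M a = row M b) : Realizes G k n M (φ ∘ Equiv.swap a b) := by
  have hn := h.le_bound
  have hσ : ∀ i < n, Equiv.swap a b i < n := fun i hi => by
    rw [Equiv.swap_apply_def]; split_ifs <;> assumption
  have hk : ∀ i < k, Equiv.swap a b i = i := fun i hi =>
    Equiv.swap_apply_of_ne_of_ne (by omega) (by omega)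
  have hadj : ∀ i < k, ∀ j < n, G.Adj (φ i) (φ (Equiv.swap a b j)) ↔ G.Adj (φ i) (φ j) := by
    intro i hi j hj
    have hi' : i < n := hi.trans_le h.le
    have key : G.Adj (φ i) (φ a) ↔ G.Adj (φ i) (φ b) := by
      have ha := h.row_iff (i := a) (j := i) (by omega)
      have hb := h.row_iff (i := b) (j := i) (by omega)
      rw [hab, hb] at ha
      simp only [hi, hi', han, hbn, or_true, true_and] at ha
      rw [G.adj_comm, ← ha, G.adj_comm]
    rw [Equiv.swap_apply_def]
    split_ifs with h1 h2
    · rw [h1, key]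
    · rw [h2, key]
    · rfl
  refine ⟨h.le, h.le_bound, fun i hi j hj e => (Equiv.swap a b).injective
    (h.inj _ (hσ i hi) _ (hσ j hj) e), fun i hi j hj => ?_, fun i hi v hv => ?_⟩
  · rw [h.linked_iff i hi j hj]
    refine and_congr_right fun hi => and_congr_right fun hj => and_congr_right fun hij => ?_
    change _ ↔ G.Adj (φ _) (φ _)
    rcases hij with hij | hij
    · rw [hk i hij, hadj i hij j hj]
    · rw [hk j hij, G.adj_comm, G.adj_comm _ (φ j), hadj j hij i hi]
  · have hv' : G.Adj (φ i) v := by simpa [hk i hi] using hv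
    obtain ⟨j, hj, rfl⟩ := h.closed i hi v hv'
    exact ⟨Equiv.swap a b j, hσ j hj, by simp⟩

/-- Among the namings of the vertices, one with the smallest sum of the indices of the known
neighbours of `k` is sorted: a violation at `j`, `j + 1` could be swapped, and the sum would drop.
-/
theorem exists_sorted (h : Realizes G k n M φ) : ∃ φ' : ℕ → V,
    Realizes G k n M φ' ∧ ∀ j, k < j → j + 1 < n → row M j = row M (j + 1) →
      G.Adj (φ' k) (φ' (j + 1)) → G.Adj (φ' k) (φ' j) := by
  classical
  induction hw : ∑ i ∈ Finset.range n, (if G.Adj (φ k) (φ i) then i else 0)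
    using Nat.strong_induction_on generalizing φ with
  | _ w ih =>
    by_contra hc
    push Not at hc
    obtain ⟨j, hkj, hjn, hrow, h1, h2⟩ := hc φ h
    have hs := h.comp_swap (a := j) (b := j + 1) (by omega) (by omega) (by omega) hjn hrow
    have hkk : Equiv.swap j (j + 1) k = k := Equiv.swap_apply_of_ne_of_ne (by omega) (by omega)
    have hlt : ∑ i ∈ Finset.range n, (if G.Adj ((φ ∘ Equiv.swap j (j + 1)) k)
        ((φ ∘ Equiv.swap j (j + 1)) i) then i else 0) < w := by
      rw [← hw]
      have e : ∑ i ∈ Finset.range n, (if G.Adj (φ k) (φ i) then Equiv.swap j (j + 1) i else 0) =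
          ∑ i ∈ Finset.range n, (if G.Adj ((φ ∘ Equiv.swap j (j + 1)) k)
            ((φ ∘ Equiv.swap j (j + 1)) i) then i else 0) := by
        refine Finset.sum_equiv (Equiv.swap j (j + 1)) (fun i => ?_) fun i _ => by simp [hkk]
        simp only [Finset.mem_range, Equiv.swap_apply_def]
        split_ifs <;> omega
      rw [← e]
      refine Finset.sum_lt_sum (fun i _ => ?_) ⟨j + 1, Finset.mem_range.2 hjn, ?_⟩
      · split_ifs with hi
        · rw [Equiv.swap_apply_def]
          split_ifs with h3 h4
          · exact absurd (h3 ▸ hi) h2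
          · omega
          · exact le_rfl
        · exact le_rfl
      · rw [if_pos h1, if_pos h1, Equiv.swap_apply_right]; omega
    obtain ⟨φ', h', hφ'⟩ := ih _ hlt hs rfl
    obtain ⟨j, h3, h4, h5, h6, h7⟩ := hc φ' h'
    exact h7 (hφ' j h3 h4 h5 h6)

/-- Exploring `k` names its neighbours outside the picture `n, n + 1, …`. They are not adjacent to
vertices explored earlier, whose neighbours all have names already, so only edges at `k` have to be
added. -/
theorem expand [G.LocallyFinite] (h : Realizes G k n M φ) (hk : k < n) {d : ℕ}
    (hd : G.degree (φ k) = d) {l : List ℕ} (hl : l.Nodup) (hmem : ∀ j, j ∈ l ↔ j < n ∧ G.Adj (φ k) (φ j)) :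
    l.length ≤ d ∧ (n + (d - l.length) ≤ 32 → ∃ φ' : ℕ → V,
      (∀ i < n, φ' i = φ i) ∧ Realizes G (k + 1) (n + (d - l.length))
        (link M k (l ++ List.range' n (d - l.length))) φ') := by
  subst hd
  classical
  have hn := h.le_bound
  set W := (G.neighborFinset (φ k)).filter fun v => ¬∃ j < n, φ j = v with hW
  have hWmem : ∀ v, v ∈ W ↔ G.Adj (φ k) v ∧ ∀ j < n, φ j ≠ v := by
    intro v; simp [hW]
  have hcard : l.length + W.card = G.degree (φ k) := by
    rw [← SimpleGraph.card_neighborFinset_eq_degree,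
      ← Finset.card_filter_add_card_filter_not (s := G.neighborFinset (φ k))
        fun v => ∃ j < n, φ j = v, ← List.toFinset_card_of_nodup hl]
    congr 1
    refine Finset.card_bij (fun j _ => φ j) ?_ ?_ ?_
    · intro j hj
      rw [List.mem_toFinset, hmem] at hj
      rw [Finset.mem_filter, SimpleGraph.mem_neighborFinset]
      exact ⟨hj.2, j, hj.1, rfl⟩
    · intro a ha b hb e
      rw [List.mem_toFinset, hmem] at ha hb
      exact h.inj a ha.1 b hb.1 e
    · intro v hv
      rw [Finset.mem_filter, SimpleGraph.mem_neighborFinset] at hv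
      obtain ⟨hv, j, hj, rfl⟩ := hv
      exact ⟨j, by rw [List.mem_toFinset, hmem]; exact ⟨hj, hv⟩, rfl⟩
  refine ⟨by omega, fun hbound => ?_⟩
  obtain ⟨m, hm⟩ : ∃ m, m = G.degree (φ k) - l.length := ⟨_, rfl⟩
  rw [← hm] at hbound ⊢
  have e : Fin m ≃ W := (Finset.equivFinOfCardEq (by omega)).symm
  set φ' : ℕ → V := fun i => if i < n then φ i else
    if hi : i - n < m then (e ⟨i - n, hi⟩ : V) else φ i with hφ'
  have hold : ∀ i < n, φ' i = φ i := fun i hi => by simp [hφ', hi]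
  have hnew : ∀ i (hi : i < m), φ' (n + i) = e ⟨i, hi⟩ := fun i hi => by simp [hφ', hi]
  have hnewW : ∀ i, n ≤ i → i < n + m → φ' i ∈ W := by
    intro i h1 h2
    obtain ⟨i, rfl⟩ := Nat.exists_eq_add_of_le h1
    rw [hnew i (by omega)]; exact (e _).2
  have hQ : ∀ j, j ∈ l ++ List.range' n m ↔ j < n + m ∧ G.Adj (φ' k) (φ' j) := by
    intro j
    rw [List.mem_append, List.mem_range'_1, hmem, hold k hk]
    by_cases hj : j < n
    · rw [hold j hj]
      constructor
      · rintro (h | h)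
        · exact ⟨by omega, h.2⟩
        · omega
      · exact fun h => Or.inl ⟨hj, h.2⟩
    · constructor
      · rintro (h | h)
        · exact absurd h.1 hj
        · exact ⟨h.2, ((hWmem _).1 (hnewW j h.1 h.2)).1⟩
      · exact fun h => Or.inr ⟨by omega, h.1⟩
  have hsep : ∀ i < k, ∀ j, n ≤ j → j < n + m → ¬G.Adj (φ' i) (φ' j) := by
    intro i hi j h1 h2 ha
    rw [hold i (by omega)] at ha
    obtain ⟨j', hj', e'⟩ := h.closed i hi _ ha
    exact ((hWmem _).1 (hnewW j h1 h2)).2 j' hj' e'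
  refine ⟨φ', hold, by omega, hbound, fun i hi j hj hij => ?_, fun i hi j hj => ?_,
    fun i hi v hv => ?_⟩
  · by_cases h1 : i < n <;> by_cases h2 : j < n
    · rw [hold i h1, hold j h2] at hij; exact h.inj i h1 j h2 hij
    · rw [hold i h1] at hij
      exact absurd hij (((hWmem _).1 (hnewW j (by omega) hj)).2 i h1)
    · rw [hold j h2] at hij
      exact absurd hij.symm (((hWmem _).1 (hnewW i (by omega) hi)).2 j h2)
    · obtain ⟨i, rfl⟩ := Nat.exists_eq_add_of_le (not_lt.1 h1)
      obtain ⟨j, rfl⟩ := Nat.exists_eq_add_of_le (not_lt.1 h2)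
      rw [hnew i (by omega), hnew j (by omega)] at hij
      have := Fin.mk.inj_iff.1 (e.injective (Subtype.ext hij))
      omega
  · rw [linked_link (by omega) (fun j hj => by have := ((hQ j).1 hj).1; omega) hj,
      h.linked_iff i hi j hj, hQ, hQ]
    constructor
    · rintro (⟨h1, h2, h3, h4⟩ | ⟨rfl, h1, h2⟩ | ⟨rfl, h1, h2⟩)
      · rw [hold i h1, hold j h2]; exact ⟨by omega, by omega, by omega, h4⟩
      · exact ⟨by omega, h1, by omega, h2⟩
      · exact ⟨h1, by omega, by omega, h2.symm⟩
    · rintro ⟨h1, h2, h3, h4⟩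
      by_cases hik : i = k
      · subst hik; exact Or.inr (Or.inl ⟨rfl, h2, h4⟩)
      by_cases hjk : j = k
      · subst hjk; exact Or.inr (Or.inr ⟨rfl, h1, h4.symm⟩)
      left
      have h1' : i < n := by
        by_contra hc
        exact hsep j (by omega) i (by omega) h1 h4.symm
      have h2' : j < n := by
        by_contra hc
        exact hsep i (by omega) j (by omega) h2 h4
      rw [hold i h1', hold j h2'] at h4
      exact ⟨h1', h2', by omega, h4⟩
  · by_cases hik : i = k
    · subst hik
      by_cases hv' : ∃ j < n, φ j = v
      · obtain ⟨j, hj, rfl⟩ := hv'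
        exact ⟨j, by omega, hold j hj⟩
      · rw [hold i hk] at hv
        have hvW : v ∈ W := (hWmem v).2 ⟨hv, fun j hj e => hv' ⟨j, hj, e⟩⟩
        obtain ⟨a, ha⟩ := e.surjective ⟨v, hvW⟩
        exact ⟨n + a, by omega, by rw [hnew a a.2, Fin.eta, ha]⟩
    · rw [hold i (by omega)] at hv
      obtain ⟨j, hj, rfl⟩ := h.closed i (by omega) v hv
      exact ⟨j, by omega, hold j hj⟩

/-- After a renaming of twins, the actual neighbours of `φ k` within the picture form one of the
sets that the search tries. -/
theorem exists_mem_oldNbrs [G.LocallyFinite] (hG : IsLocallyFlat G) {D : ℕ}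
    (hD : ∀ v, G.degree v ≤ D) (h : Realizes G k n M φ) (hk : k < n) :
    ∃ φ' : ℕ → V, Realizes G k n M φ' ∧ ∃ N ∈ oldNbrs D M k n,
      ∀ j, j ∈ bitList N ↔ j < n ∧ G.Adj (φ' k) (φ' j) := by
  classical
  have hn := h.le_bound
  obtain ⟨φ', h', hs⟩ := h.exists_sorted
  have hrow : ∀ j, (row M k).testBit j = true ↔ j < k ∧ G.Adj (φ' k) (φ' j) := by
    intro j
    rw [h'.row_iff (by omega)]
    constructor
    · exact fun hj => ⟨by omega, hj.2.2.2⟩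
    · exact fun hj => ⟨hk, by omega, Or.inr hj.1, hj.2⟩
  -- Only the first half of `expand` is needed: the neighbours within the picture number at most the
  -- degree, which bounds how many may be added.
  have hlen := (h'.expand hk rfl
    (l := (List.range n).filter fun j => G.Adj (φ' k) (φ' j)) (List.nodup_range.filter _)
    (by simp)).1
  obtain ⟨N, hN, hb⟩ := exists_mem_extensions M k (fun j => j < n ∧ G.Adj (φ' k) (φ' j))
    (interval (k + 1) (n - (k + 1))) (D - size (nbrs M k)) (row M k) (by
      have h1 : (nbrs M k ++ (interval (k + 1) (n - (k + 1))).filter fun j =>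
          j < n ∧ G.Adj (φ' k) (φ' j)).length ≤
          ((List.range n).filter fun j => G.Adj (φ' k) (φ' j)).length := by
        refine List.Subperm.length_le (List.subperm_of_subset ?_ fun j hj => ?_)
        · refine List.nodup_append'.2 ⟨nodup_nbrs _ _,
            (by rw [interval_eq_range']; exact List.Nodup.filter _ List.nodup_range'),
            fun j h1 h2 => ?_⟩
          have h3 := (mem_interval.1 (List.mem_of_mem_filter h2)).1
          rw [mem_nbrs, ← testBit_row, hrow] at h1
          omega
        · rw [List.mem_filter, List.mem_range]
          rcases List.mem_append.1 hj with hj | hj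
          · rw [mem_nbrs, ← testBit_row, hrow] at hj
            exact ⟨by omega, by simpa using hj.2⟩
          · rw [List.mem_filter, decide_eq_true_iff] at hj
            exact ⟨hj.2.1, by simpa using hj.2.2⟩
      rw [List.length_append] at h1
      have := hD (φ' k)
      rw [size_eq_length]
      omega) (fun N' hN' => h'.girthOK_eq_true hG hk fun j hj => (hN' j hj).elim
        (fun hj => by rw [hrow] at hj; exact ⟨by omega, hj.2⟩) id)
  have hN' : ∀ j, N.testBit j = true ↔ j < n ∧ G.Adj (φ' k) (φ' j) := by
    intro j
    rw [hb, hrow, mem_interval]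
    constructor
    · rintro (hj | hj)
      · exact ⟨by omega, hj.2⟩
      · exact hj.2
    · intro hj
      rcases lt_trichotomy j k with h1 | rfl | h1
      · exact Or.inl ⟨h1, hj.2⟩
      · exact absurd hj.2 (G.loopless.irrefl _)
      · exact Or.inr ⟨by omega, hj⟩
  refine ⟨φ', h', N, ?_, fun j => ?_⟩
  · rw [oldNbrs, select_eq_filter, List.mem_filter]
    refine ⟨hN, ?_⟩
    simp only [twinOK, rec_eq_cond, hasBit_eq_testBit, beq_eq_decide]
    refine allOf_eq_true.2 fun j hj => ?_
    rw [mem_interval, show Nat.sub n (Nat.add k 2) = n - (k + 2) from rfl] at hj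
    cases h1 : N.testBit j
    swap
    · rfl
    cases h2 : N.testBit (Nat.succ j)
    · rfl
    by_cases h3 : row M j = row M (Nat.succ j)
    · have := (hN' j).2 ⟨by omega, hs j (by omega) (by omega) h3 ((hN' _).1 h2).2⟩
      rw [h1] at this; cases this
    · rw [decide_eq_false h3]; rfl
  · rw [mem_bitList, hN']
    exact ⟨fun hj => hj.2, fun hj => ⟨by omega, hj⟩⟩

theorem explore_succ (D : ℕ) (degs : List ℕ) (leaf : ℕ → ℕ → Bool) (f k n M : ℕ) :
    explore D degs leaf (f + 1) k n M = cond (decide (k = n)) (leaf n M)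
      (allOf (fun N => allOf (fun d => cond (decide ((bitList N).length ≤ d))
        (cond (decide (n + (d - (bitList N).length) ≤ 32))
          (cond (flatOK (RicciFlat.rehash (link M k
              (bitList N ++ interval n (d - (bitList N).length)))) k)
            (explore D degs leaf f (k + 1) (n + (d - (bitList N).length))
              (RicciFlat.rehash (link M k (bitList N ++ interval n (d - (bitList N).length)))))
            true) false) true) degs) (oldNbrs D M k n)) := by
  rw [← beq_eq_decide]
  simp only [explore, force_eq, rec_eq_cond, size_eq_length, join_eq_append, ← ble_eq_decide]
  rfl

/-- Following the actual neighbourhoods and degrees in `G` picks one branch at every step. Its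
pictures realize `G` and hence pass `flatOK`, so a successful search must end this branch at an
accepted leaf. -/
theorem exists_leaf [G.LocallyFinite] (hG : IsLocallyFlat G) {D : ℕ} {degs : List ℕ}
    {leaf : ℕ → ℕ → Bool} (hD : ∀ v, G.degree v ≤ D) (hdegs : ∀ v, G.degree v ∈ degs) {f : ℕ}
    (h : Realizes G k n M φ) (he : explore D degs leaf f k n M = true) :
    ∃ n M, ∃ φ : ℕ → V, leaf n M = true ∧ Realizes G n n M φ := by
  induction f generalizing k n M φ with
  | zero => cases he
  | succ f ih =>
    rw [explore_succ] at he
    by_cases hkn : k = n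
    · subst hkn
      rw [decide_eq_true rfl] at he
      exact ⟨k, M, φ, he, h⟩
    · rw [decide_eq_false hkn, cond_false] at he
      have hk : k < n := lt_of_le_of_ne h.le hkn
      obtain ⟨φ', h', N, hN, hb⟩ := h.exists_mem_oldNbrs hG hD hk
      have he' := allOf_eq_true.1 (allOf_eq_true.1 he N hN) _ (hdegs (φ' k))
      obtain ⟨h1, h2⟩ := h'.expand hk rfl (nodup_bitList N) hb
      rw [decide_eq_true h1, cond_true] at he'
      by_cases h32 : n + (G.degree (φ' k) - (bitList N).length) ≤ 32
      · obtain ⟨φ'', -, h3⟩ := h2 h32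
        rw [← interval_eq_range'] at h3
        have h4 := h3.rehash
        have h5 := h4.flatOK_eq_true hG
        rw [decide_eq_true h32, cond_true, h5, cond_true] at he'
        exact ih h4 he'
      · rw [decide_eq_false h32] at he'
        cases he'

/-- When all vertices of the picture are explored, it is closed under adjacency; a connected graph
has no room for more. -/
theorem surjective [G.LocallyFinite] (h : Realizes G n n M φ) (hG : G.Connected) (hn : 0 < n)
    (v : V) : ∃ i < n, φ i = v := by
  obtain ⟨p⟩ := hG.preconnected (φ 0) v
  suffices ∀ u w (p : G.Walk u w), (∃ i < n, φ i = u) → ∃ i < n, φ i = w from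
    this _ _ p ⟨0, hn, rfl⟩
  intro u w p
  induction p with
  | nil => exact id
  | cons hadj _ ih =>
    rintro ⟨i, hi, rfl⟩
    exact ih (h.closed i hi _ hadj)

end Realizes

/-! ### Soundness of the isomorphism search -/

/-- `g` maps the first `m` vertices of `M` injectively to vertices of `T` below `n` and respects
adjacency. -/
def IsPartialIso (n M T : ℕ) (g : ℕ → ℕ) (m : ℕ) : Prop :=
  ∀ i < m, g i < n ∧ ∀ j < i, g i ≠ g j ∧ hasBit (row M i) j = hasBit (row T (g i)) (g j)

/-- The head of the reversed list is the image of `m - 1`. For `m = 0` the list is empty, so the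
truncated subtraction is harmless. -/
theorem extendsIso_spec {R S s : ℕ} {g : ℕ → ℕ} {m : ℕ}
    (h : extendsIso R S s ((List.range m).map g).reverse (m - 1) = true) :
    ∀ j < m, s ≠ g j ∧ hasBit R j = hasBit S (g j) := by
  induction m with
  | zero => intro j hj; omega
  | succ m ih =>
    rw [List.range_succ, List.map_append, List.reverse_append] at h
    simp only [List.map_cons, List.map_nil, List.reverse_singleton, List.singleton_append,
      Nat.add_sub_cancel] at h
    have e : ∀ t l, extendsIso R S s (t :: l) m = cond (Nat.beq s t) false
        (cond (hasBit R m) (cond (hasBit S t) (extendsIso R S s l (m - 1)) false)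
          (cond (hasBit S t) false (extendsIso R S s l (m - 1)))) := by
      intro t l
      simp only [← rec_eq_cond]
      rfl
    rw [e, beq_eq_decide] at h
    by_cases h0 : s = g m
    · rw [decide_eq_true h0] at h; cases h
    rw [decide_eq_false h0, cond_false] at h
    have key : hasBit R m = hasBit S (g m) ∧
        extendsIso R S s ((List.range m).map g).reverse (m - 1) = true := by
      cases h1 : hasBit R m <;> cases h2 : hasBit S (g m) <;> rw [h1, h2] at h <;>
        first | exact ⟨rfl, h⟩ | cases h
    intro j hj
    rcases Nat.lt_succ_iff_lt_or_eq.1 hj with hj | rfl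
    · exact ih key.2 j hj
    · exact ⟨h0, key.1⟩

theorem findIso_spec {n M T f : ℕ} {g : ℕ → ℕ} {m : ℕ} (hg : IsPartialIso n M T g m)
    (h : findIso n M T f m ((List.range m).map g).reverse = true) :
    ∃ g', IsPartialIso n M T g' (m + f) := by
  induction f generalizing g m with
  | zero => exact ⟨g, hg⟩
  | succ f ih =>
    have e : findIso n M T (f + 1) m ((List.range m).map g).reverse =
        anyOf (fun s => cond (extendsIso (row M m) (row T s) s ((List.range m).map g).reverse (m - 1))
          (findIso n M T f (m + 1) (s :: ((List.range m).map g).reverse)) false) (interval 0 n) := by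
      simp only [findIso, force_eq, ← rec_eq_cond]
      rfl
    rw [e] at h
    obtain ⟨s, hs, h⟩ := anyOf_eq_true.1 h
    cases h1 : extendsIso (row M m) (row T s) s ((List.range m).map g).reverse (m - 1)
    · rw [h1] at h; cases h
    rw [h1, cond_true] at h
    have h2 := extendsIso_spec h1
    have hlt : ∀ i < m, Function.update g m s i = g i := fun i hi =>
      Function.update_of_ne (by omega) _ _
    have e : (s :: ((List.range m).map g).reverse) =
        ((List.range (m + 1)).map (Function.update g m s)).reverse := by
      rw [List.range_succ, List.map_append, List.reverse_append]
      simp only [List.map_cons, List.map_nil, List.reverse_singleton, List.singleton_append,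
        Function.update_self]
      congr 2
      exact List.map_congr_left fun i hi => (hlt i (List.mem_range.1 hi)).symm
    rw [e] at h
    have hg1 : IsPartialIso n M T (Function.update g m s) (m + 1) := by
      intro i hi
      rcases Nat.lt_succ_iff_lt_or_eq.1 hi with hi | rfl
      · rw [hlt i hi]
        exact ⟨(hg i hi).1, fun j hj => by rw [hlt j (by omega)]; exact (hg i hi).2 j hj⟩
      · rw [Function.update_self]
        refine ⟨by rw [mem_interval] at hs; omega, fun j hj => ?_⟩
        rw [hlt j hj]
        exact h2 j hj
    obtain ⟨g', hg'⟩ := ih hg1 h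
    exact ⟨g', by rwa [show m + 1 + f = m + (f + 1) by omega] at hg'⟩

theorem Realizes.nonempty_iso [G.LocallyFinite] {n M : ℕ} {φ : ℕ → V} (h : Realizes G n n M φ)
    (hG : G.Connected) {W : Type*} [Fintype W] {H : SimpleGraph W} {w : ℕ → W} {T n' : ℕ}
    (hn : 0 < n') (hcard : Fintype.card W = n') (hw : ∀ i < n', ∀ j < n', w i = w j → i = j)
    (hT : ∀ i < n', ∀ j < n', H.Adj (w i) (w j) ↔ hasBit (row T i) j = true)
    (hiso : isIso n' T n M = true) : Nonempty (G ≃g H) := by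
  have hn' : n = n' := by
    by_contra hc
    rw [isIso, rec_eq_cond, beq_eq_decide, decide_eq_false hc] at hiso
    cases hiso
  subst hn'
  rw [isIso, rec_eq_cond, beq_eq_decide, decide_eq_true rfl, cond_true] at hiso
  obtain ⟨g, hg⟩ := findIso_spec (g := id) (m := 0) (fun i hi => by omega) hiso
  rw [zero_add] at hg
  have hbound := h.le_bound
  let e₁ : Fin n ≃ V := Equiv.ofBijective (fun i : Fin n => φ i)
    ⟨fun i j hij => Fin.ext (h.inj i i.2 j j.2 hij), fun v => by
      obtain ⟨i, hi, rfl⟩ := h.surjective hG hn v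
      exact ⟨⟨i, hi⟩, rfl⟩⟩
  have hinj : Function.Injective fun i : Fin n => w (g i) := by
    intro i j hij
    have := hw _ (hg i i.2).1 _ (hg j j.2).1 hij
    rcases lt_trichotomy (i : ℕ) j with h1 | h1 | h1
    · exact absurd this.symm ((hg j j.2).2 i h1).1
    · exact Fin.ext h1
    · exact absurd this ((hg i i.2).2 j h1).1
  let e₂ : Fin n ≃ W := Equiv.ofBijective (fun i : Fin n => w (g i))
    ((Fintype.bijective_iff_injective_and_card _).2 ⟨hinj, by simp [hcard]⟩)
  have hM : ∀ i < n, ∀ j < n, G.Adj (φ i) (φ j) ↔ hasBit (row M i) j = true := by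
    intro i hi j hj
    rw [hasBit_eq_testBit, h.row_iff (by omega)]
    simp [hi, hj]
  have key : ∀ i j : Fin n, (j : ℕ) < i → (H.Adj (w (g i)) (w (g j)) ↔ G.Adj (φ i) (φ j)) := by
    intro i j hij
    rw [hM i i.2 j j.2, hT _ (hg i i.2).1 _ (hg j j.2).1, ((hg i i.2).2 j hij).2]
  refine ⟨⟨e₁.symm.trans e₂, fun {a b} => ?_⟩⟩
  obtain ⟨i, rfl⟩ := e₁.surjective a
  obtain ⟨j, rfl⟩ := e₁.surjective b
  simp only [Equiv.trans_apply, Equiv.symm_apply_apply]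
  change H.Adj (w (g i)) (w (g j)) ↔ G.Adj (φ i) (φ j)
  rcases lt_trichotomy (i : ℕ) j with h1 | h1 | h1
  · rw [H.adj_comm, G.adj_comm, key j i h1]
  · rw [Fin.ext h1]; simp
  · exact key i j h1

end

/-! ### Distances under girth five -/

section

variable {V : Type*} {G : SimpleGraph V}

theorem not_triangle_of_egirth (hg : 5 ≤ G.egirth) (u v w : V) (huv : G.Adj u v)
    (hvw : G.Adj v w) : ¬G.Adj u w := by
  intro huw
  have h : (SimpleGraph.Walk.cons huv (.cons hvw (.cons huw.symm .nil))).IsCycle := by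
    rw [SimpleGraph.Walk.cons_isCycle_iff]
    simp [SimpleGraph.Walk.cons_isPath_iff, huv.ne, hvw.ne, huw.ne, huv.ne', huw.ne']
  have := SimpleGraph.le_egirth.1 hg _ _ h
  norm_num at this

theorem not_square_of_egirth (hg : 5 ≤ G.egirth) (u v w z : V) (h1 : G.Adj u w) (h2 : G.Adj v w)
    (h3 : G.Adj u z) (h4 : G.Adj v z) (huv : u ≠ v) : w = z := by
  by_contra hwz
  have h : (SimpleGraph.Walk.cons h1 (.cons h2.symm (.cons h4 (.cons h3.symm .nil)))).IsCycle := by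
    rw [SimpleGraph.Walk.cons_isCycle_iff]
    simp [SimpleGraph.Walk.cons_isPath_iff, h1.ne, h3.ne, h4.ne, h1.ne', h2.ne', h3.ne', huv, huv.symm, hwz]
  have := SimpleGraph.le_egirth.1 hg _ _ h
  norm_num at this

theorem two_le_dist (hG : G.Connected) {u v : V} (h : u ≠ v) (ha : ¬G.Adj u v) :
    2 ≤ G.dist u v := by
  have h0 := hG.pos_dist_of_ne h
  have h1 : G.dist u v ≠ 1 := fun e => ha (SimpleGraph.dist_eq_one_iff_adj.1 e)
  omega

theorem three_le_dist (hG : G.Connected) {u v : V} (h : u ≠ v) (ha : ¬G.Adj u v)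
    (hm : ¬∃ z, G.Adj u z ∧ G.Adj v z) : 3 ≤ G.dist u v := by
  have h0 := two_le_dist hG h ha
  have h1 : G.dist u v ≠ 2 := fun e => by
    obtain ⟨p, hp⟩ := hG.exists_walk_length_eq_dist u v
    rw [e] at hp
    match p, hp with
    | .cons h1 (.cons h2 .nil), _ => exact hm ⟨_, h1, h2.symm⟩
  omega

theorem dist_le_two {u v : V} (hm : ∃ z, G.Adj u z ∧ G.Adj v z) : G.dist u v ≤ 2 := by
  obtain ⟨z, h1, h2⟩ := hm
  exact SimpleGraph.dist_le (.cons h1 (.cons h2.symm .nil))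

/-! ### Couplings -/

theorem le_mapDomain {α β : Type*} (φ : α → β) {A : α →₀ ℝ} (hA : ∀ p, 0 ≤ A p) (p : α) :
    A p ≤ A.mapDomain φ (φ p) := by
  classical
  by_cases hp : p ∈ A.support
  · rw [Finsupp.mapDomain, Finsupp.sum_apply, Finsupp.sum]
    refine le_trans ?_ (Finset.single_le_sum (f := fun q => (Finsupp.single (φ q) (A q)) (φ p))
      (fun q _ => ?_) hp)
    · simp
    · simp only [Finsupp.single_apply]; split_ifs <;> simp [hA]
  · rw [Finsupp.notMem_support_iff.1 hp, Finsupp.mapDomain, Finsupp.sum_apply, Finsupp.sum]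
    refine Finset.sum_nonneg fun q _ => ?_
    simp only [Finsupp.single_apply]; split_ifs <;> simp [hA]

/-- Weak Kantorovich duality, with two potentials instead of one Lipschitz function; the inequality
is needed only on the supports, because a coupling lives on their product. -/
theorem IsCoupling.sum_sub_sum_le {μ ν : V →₀ ℝ} {A : V × V →₀ ℝ} (hA : IsCoupling μ ν A)
    {f g : V → ℝ} {d : V → V → ℝ} (h : ∀ u v, μ u ≠ 0 → ν v ≠ 0 → f u - g v ≤ d u v) :
    ((μ.sum fun u a => a * f u) - ν.sum fun v b => b * g v) ≤ A.sum fun p a => a * d p.1 p.2 := by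
  obtain ⟨h0, rfl, rfl⟩ := hA
  rw [Finsupp.sum_mapDomain_index (by simp) (by intros; ring),
    Finsupp.sum_mapDomain_index (by simp) (by intros; ring), ← Finsupp.sum_sub]
  refine Finset.sum_le_sum fun p hp => ?_
  have hpos : 0 < A p := lt_of_le_of_ne (h0 p) (Ne.symm (Finsupp.mem_support_iff.1 hp))
  change A p * f p.1 - A p * g p.2 ≤ A p * d p.1 p.2
  rw [← mul_sub]
  exact mul_le_mul_of_nonneg_left (h _ _ (hpos.trans_le (le_mapDomain Prod.fst h0 p)).ne'
    (hpos.trans_le (le_mapDomain Prod.snd h0 p)).ne') hpos.le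

/-- Some coupling of `μ` and `ν` has cost at most `c`. -/
def CanMove (G : SimpleGraph V) (μ ν : V →₀ ℝ) (c : ℝ) : Prop :=
  ∃ A : V × V →₀ ℝ, IsCoupling μ ν A ∧ (A.sum fun p a => a * (G.dist p.1 p.2 : ℝ)) ≤ c

theorem CanMove.add {μ ν μ' ν' : V →₀ ℝ} {c c' : ℝ} (h : CanMove G μ ν c)
    (h' : CanMove G μ' ν' c') : CanMove G (μ + μ') (ν + ν') (c + c') := by
  obtain ⟨A, ⟨h0, h1, h2⟩, h3⟩ := h
  obtain ⟨A', ⟨h0', h1', h2'⟩, h3'⟩ := h'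
  refine ⟨A + A', ⟨fun p => add_nonneg (h0 p) (h0' p), ?_, ?_⟩, ?_⟩
  · rw [Finsupp.mapDomain_add, h1, h1']
  · rw [Finsupp.mapDomain_add, h2, h2']
  · rw [Finsupp.sum_add_index' (by simp) (by intros; ring)]
    exact add_le_add h3 h3'

theorem canMove_single {u v : V} {a c : ℝ} (ha : 0 ≤ a) (hc : (G.dist u v : ℝ) ≤ c) :
    CanMove G (Finsupp.single u a) (Finsupp.single v a) (a * c) := by
  refine ⟨Finsupp.single (u, v) a, ⟨fun p => ?_, ?_, ?_⟩, ?_⟩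
  · classical
    rw [Finsupp.single_apply]; split_ifs <;> simp [ha]
  · rw [Finsupp.mapDomain_single]
  · rw [Finsupp.mapDomain_single]
  · rw [Finsupp.sum_single_index (by simp)]
    exact mul_le_mul_of_nonneg_left hc ha

theorem canMove_sum {ι : Type*} (s : Finset ι) {μ ν : ι → V →₀ ℝ} {c : ι → ℝ}
    (h : ∀ i ∈ s, CanMove G (μ i) (ν i) (c i)) :
    CanMove G (∑ i ∈ s, μ i) (∑ i ∈ s, ν i) (∑ i ∈ s, c i) := by
  classical
  induction s using Finset.induction_on with
  | empty => exact ⟨0, ⟨by simp, by simp, by simp⟩, by simp⟩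
  | insert i s hi ih =>
    rw [Finset.sum_insert hi, Finset.sum_insert hi, Finset.sum_insert hi]
    exact (h i (by simp)).add (ih fun j hj => h j (by simp [hj]))

theorem CanMove.transportDist_le {μ ν : V →₀ ℝ} {c : ℝ} (h : CanMove G μ ν c) :
    transportDist G μ ν ≤ c := by
  obtain ⟨A, hA, hc⟩ := h
  refine le_trans (csInf_le (show BddBelow _ from ⟨0, ?_⟩) ⟨A, hA, rfl⟩) hc
  rintro _ ⟨B, hB, rfl⟩
  exact Finset.sum_nonneg fun p _ => mul_nonneg (hB.1 p) (Nat.cast_nonneg _)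

/-- The product coupling. It is needed because `sInf` of the empty set is 0, which would spoil lower
bounds for `transportDist`. -/
theorem exists_isCoupling {μ ν : V →₀ ℝ} (hμ : ∀ u, 0 ≤ μ u) (hν : ∀ v, 0 ≤ ν v)
    (h1 : (μ.sum fun _ a => a) = 1) (h2 : (ν.sum fun _ b => b) = 1) :
    ∃ A : V × V →₀ ℝ, IsCoupling μ ν A := by
  classical
  refine ⟨∑ u ∈ μ.support, ∑ v ∈ ν.support, Finsupp.single (u, v) (μ u * ν v), fun p => ?_, ?_, ?_⟩
  · rw [Finsupp.finsetSum_apply]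
    refine Finset.sum_nonneg fun u _ => ?_
    rw [Finsupp.finsetSum_apply]
    refine Finset.sum_nonneg fun v _ => ?_
    rw [Finsupp.single_apply]; split_ifs
    · exact mul_nonneg (hμ u) (hν v)
    · exact le_rfl
  · simp only [Finsupp.mapDomain_finsetSum, Finsupp.mapDomain_single]
    conv_rhs => rw [← Finsupp.sum_single μ]
    refine Finset.sum_congr rfl fun u _ => ?_
    rw [← Finsupp.single_finsetSum, ← Finset.mul_sum, show ∑ v ∈ ν.support, ν v = 1 from h2, mul_one]
  · simp only [Finsupp.mapDomain_finsetSum, Finsupp.mapDomain_single]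
    rw [Finset.sum_comm]
    conv_rhs => rw [← Finsupp.sum_single ν]
    refine Finset.sum_congr rfl fun v _ => ?_
    rw [← Finsupp.single_finsetSum, ← Finset.sum_mul, show ∑ u ∈ μ.support, μ u = 1 from h1, one_mul]

/-! ### Lazy walks and curvature -/

section
variable [G.LocallyFinite]

theorem sum_lazyWalk (α : ℝ) (x : V) (f : V → ℝ) :
    ((lazyWalk G α x).sum fun u a => a * f u) =
      α * f x + (1 - α) / (G.degree x : ℝ) * ∑ v ∈ G.neighborFinset x, f v := by
  rw [lazyWalk, Finsupp.sum_add_index' (by simp) (by intros; ring),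
    Finsupp.sum_single_index (by simp),
    ← Finsupp.sum_finsetSum_index (by simp) (by intros; ring), Finset.mul_sum]
  congr 1
  exact Finset.sum_congr rfl fun v _ => Finsupp.sum_single_index (by simp)

theorem lazyWalk_nonneg {α : ℝ} (h0 : 0 ≤ α) (h1 : α ≤ 1) (x u : V) : 0 ≤ lazyWalk G α x u := by
  classical
  rw [lazyWalk, Finsupp.add_apply, Finsupp.finsetSum_apply]
  refine add_nonneg ?_ (Finset.sum_nonneg fun v _ => ?_)
  · rw [Finsupp.single_apply]; split_ifs <;> simp [h0]
  · rw [Finsupp.single_apply]; split_ifs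
    · exact div_nonneg (by linarith) (Nat.cast_nonneg _)
    · exact le_rfl

theorem eq_or_adj_of_lazyWalk_ne_zero {α : ℝ} {x u : V} (h : lazyWalk G α x u ≠ 0) :
    u = x ∨ G.Adj x u := by
  classical
  by_contra hc
  push Not at hc
  refine h ?_
  rw [lazyWalk, Finsupp.add_apply, Finsupp.finsetSum_apply, Finsupp.single_eq_of_ne hc.1, zero_add]
  refine Finset.sum_eq_zero fun v hv => Finsupp.single_eq_of_ne ?_
  rintro rfl
  exact hc.2 ((G.mem_neighborFinset x _).1 hv)

theorem le_transportDist {α : ℝ} (h0 : 0 ≤ α) (h1 : α ≤ 1) {x y : V} (hx : 0 < G.degree x)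
    (hy : 0 < G.degree y) {f g : V → ℝ} (h : ∀ u v, u = x ∨ G.Adj x u → v = y ∨ G.Adj y v →
      f u - g v ≤ (G.dist u v : ℝ)) :
    (α * f x + (1 - α) / (G.degree x : ℝ) * ∑ v ∈ G.neighborFinset x, f v) -
      (α * g y + (1 - α) / (G.degree y : ℝ) * ∑ v ∈ G.neighborFinset y, g v) ≤
      transportDist G (lazyWalk G α x) (lazyWalk G α y) := by
  have total : ∀ z, 0 < G.degree z → ((lazyWalk G α z).sum fun _ a => a) = 1 := by
    intro z hz
    have := sum_lazyWalk (G := G) α z fun _ => 1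
    simp only [mul_one, Finset.sum_const, SimpleGraph.card_neighborFinset_eq_degree,
      nsmul_eq_mul] at this
    rw [this]
    have : (G.degree z : ℝ) ≠ 0 := by positivity
    field_simp
    ring
  obtain ⟨A, hA⟩ := exists_isCoupling (lazyWalk_nonneg h0 h1 x) (lazyWalk_nonneg h0 h1 y)
    (total x hx) (total y hy)
  refine le_csInf ⟨_, A, hA, rfl⟩ ?_
  rintro _ ⟨B, hB, rfl⟩
  rw [← sum_lazyWalk, ← sum_lazyWalk]
  exact hB.sum_sub_sum_le (d := fun u v => (G.dist u v : ℝ)) fun u v hu hv =>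
    h u v (eq_or_adj_of_lazyWalk_ne_zero hu) (eq_or_adj_of_lazyWalk_ne_zero hv)

/-- The hypothesis says $\kappa_\alpha/(1-\alpha)\le K$ for all $\alpha$, and the limit is 0. The
next lemma is the counterpart for lower bounds, with $\varepsilon=1-\alpha$. -/
theorem nonneg_of_le_transportDist {x y : V} (hxy : G.Adj x y) (h : HasRicciCurvature G x y 0)
    {K : ℝ} (hK : ∀ α : ℝ, 0 < α → α < 1 →
      1 - K * (1 - α) ≤ transportDist G (lazyWalk G α x) (lazyWalk G α y)) : 0 ≤ K := by
  refine le_of_tendsto h ?_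
  filter_upwards [Ioo_mem_nhdsLT (show (0 : ℝ) < 1 by norm_num)] with α hα
  rw [alphaCurvature, SimpleGraph.dist_eq_one_iff_adj.2 hxy, Nat.cast_one, div_one,
    div_le_iff₀ (by linarith [hα.2])]
  linarith [hK α hα.1 hα.2]

theorem nonpos_of_canMove {x y : V} (hxy : G.Adj x y) (h : HasRicciCurvature G x y 0)
    {K : ℝ} (hK : ∀ ε : ℝ, 0 < ε → ε < 1 / 2 →
      CanMove G (lazyWalk G (1 - ε) x) (lazyWalk G (1 - ε) y) (1 - K * ε)) : K ≤ 0 := by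
  refine ge_of_tendsto h ?_
  filter_upwards [Ioo_mem_nhdsLT (show (1 / 2 : ℝ) < 1 by norm_num)] with α hα
  have := (hK (1 - α) (by linarith [hα.2]) (by linarith [hα.1])).transportDist_le
  rw [sub_sub_cancel] at this
  rw [alphaCurvature, SimpleGraph.dist_eq_one_iff_adj.2 hxy, Nat.cast_one, div_one,
    le_div_iff₀ (by linarith [hα.2])]
  linarith

/-- The right-hand side is an upper bound for the curvature. It comes from potentials that reward
mass in `S` and `T`, pairwise at distance 3, and penalise the mass that already sits on the edge. -/
theorem curvature_bound (hG : G.Connected) (hg : 5 ≤ G.egirth) {x y : V} (hxy : G.Adj x y)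
    (h : HasRicciCurvature G x y 0) {S T : Finset V} (hS : ∀ u ∈ S, G.Adj x u ∧ u ≠ y)
    (hT : ∀ v ∈ T, G.Adj y v ∧ v ≠ x) (hST : ∀ u ∈ S, ∀ v ∈ T, ¬∃ z, G.Adj u z ∧ G.Adj v z) :
    0 ≤ (1 - (S.card : ℝ)) / G.degree x + (1 - (T.card : ℝ)) / G.degree y := by
  classical
  have hx : 0 < G.degree x := (G.degree_pos_iff_exists_adj x).2 ⟨y, hxy⟩
  have hy : 0 < G.degree y := (G.degree_pos_iff_exists_adj y).2 ⟨x, hxy.symm⟩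
  have hx' : (G.degree x : ℝ) ≠ 0 := by positivity
  have hy' : (G.degree y : ℝ) ≠ 0 := by positivity
  refine nonneg_of_le_transportDist hxy h fun α h0 h1 => ?_
  -- With these potentials `f u - g v` is at most 3, and equals 3 only on `S × T`; it is at most 2
  -- if just one of `u ∈ S`, `v ∈ T` holds, and each of `u = y`, `v = x` lowers it by 1.
  have key := le_transportDist (G := G) h0.le h1.le hx hy
    (f := fun u => 1 + (if u ∈ S then 1 else 0) - (if u = y then 1 else 0))
    (g := fun v => (if v = x then 1 else 0) - (if v ∈ T then 1 else 0)) ?_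
  · refine le_trans (le_of_eq ?_) key
    have hxS : x ∉ S := fun hc => (hS x hc).1.ne rfl
    have hyT : y ∉ T := fun hc => (hT y hc).1.ne rfl
    have e1 : ∑ u ∈ G.neighborFinset x, ((if u ∈ S then 1 else 0) : ℝ) = S.card := by
      rw [Finset.sum_ite_mem, Finset.inter_eq_right.2 fun u hu => by simpa using (hS u hu).1]
      simp
    have e2 : ∑ v ∈ G.neighborFinset y, ((if v ∈ T then 1 else 0) : ℝ) = T.card := by
      rw [Finset.sum_ite_mem, Finset.inter_eq_right.2 fun v hv => by simpa using (hT v hv).1]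
      simp
    have e3 : ∑ u ∈ G.neighborFinset x, ((if u = y then 1 else 0) : ℝ) = 1 := by
      rw [Finset.sum_ite_eq', if_pos (by simpa using hxy)]
    have e4 : ∑ v ∈ G.neighborFinset y, ((if v = x then 1 else 0) : ℝ) = 1 := by
      rw [Finset.sum_ite_eq', if_pos (by simpa using hxy.symm)]
    simp only [Finset.sum_sub_distrib, Finset.sum_add_distrib, e1, e2, e3, e4, Finset.sum_const,
      SimpleGraph.card_neighborFinset_eq_degree, nsmul_eq_mul, if_neg hxS, if_neg hyT,
      if_neg hxy.ne, if_neg hxy.ne']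
    field_simp
    ring
  · intro u v hu hv
    have tri := not_triangle_of_egirth hg
    have sq := not_square_of_egirth hg
    have d1 : ∀ a b : V, a ≠ b → (1 : ℝ) ≤ G.dist a b := fun a b hab => by
      exact_mod_cast hG.pos_dist_of_ne hab
    have d2 : ∀ a b : V, a ≠ b → ¬G.Adj a b → (2 : ℝ) ≤ G.dist a b := fun a b hab h => by
      exact_mod_cast two_le_dist hG hab h
    have d3 : ∀ a b : V, a ≠ b → ¬G.Adj a b → (¬∃ z, G.Adj a z ∧ G.Adj b z) →
      (3 : ℝ) ≤ G.dist a b := fun a b hab h h' => by exact_mod_cast three_le_dist hG hab h h'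
    have d0 : (0 : ℝ) ≤ G.dist u v := Nat.cast_nonneg _
    -- the neighbours of `x` and of `y` are distinct and not adjacent
    have far : ∀ a b, G.Adj x a → a ≠ y → G.Adj y b → b ≠ x → a ≠ b ∧ ¬G.Adj a b := by
      intro a b ha hay hb hbx
      refine ⟨?_, fun hab => ?_⟩
      · rintro rfl; exact tri _ _ _ hxy hb ha
      · exact hbx (sq y a b x hb hab hxy.symm ha.symm (Ne.symm hay))
    have hvT : v ∈ T → v ≠ x ∧ G.Adj y v ∧ v ≠ y := fun h =>
      ⟨(hT v h).2, (hT v h).1, (hT v h).1.ne'⟩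
    by_cases hvx : v = x
    · subst hvx
      have : v ∉ T := fun h => (hvT h).1 rfl
      by_cases huS : u ∈ S
      · have := d1 u v (hS u huS).1.ne'
        simp only [(hS u huS).2, if_true, if_false, *]; linarith
      · simp only [if_true, if_false, *]
        split_ifs <;> linarith
    · by_cases huy : u = y
      · subst huy
        have huS : u ∉ S := fun h => (hS u h).2 rfl
        by_cases hvT' : v ∈ T
        · have := d1 u v (hvT hvT').2.2.symm
          simp only [huS, hvx, hvT', if_true, if_false]; linarith
        · simp only [huS, hvx, hvT', if_true, if_false]; linarith
      · by_cases huS : u ∈ S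
        · have hux := (hS u huS).1
          by_cases hvT' : v ∈ T
          · have hf := far u v hux huy (hvT hvT').2.1 hvx
            have := d3 u v hf.1 hf.2 (hST u huS v hvT')
            simp only [huS, huy, hvx, hvT', if_true, if_false]; linarith
          · have : (2 : ℝ) ≤ G.dist u v := by
              rcases hv with rfl | hv
              · exact d2 u v huy fun h => tri _ _ _ hux h hxy
              · have hf := far u v hux huy hv hvx
                exact d2 u v hf.1 hf.2
            simp only [huS, huy, hvx, hvT', if_true, if_false]; linarith
        · by_cases hvT' : v ∈ T
          · have : (2 : ℝ) ≤ G.dist u v := by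
              rcases hu with rfl | hu
              · exact d2 u v (Ne.symm hvx) fun h => tri _ _ _ hxy (hvT hvT').2.1 h
              · have hf := far u v hu huy (hvT hvT').2.1 hvx
                exact d2 u v hf.1 hf.2
            simp only [huS, huy, hvx, hvT', if_true, if_false]; linarith
          · have : (1 : ℝ) ≤ G.dist u v := by
              refine d1 u v ?_
              rintro rfl
              rcases hu with rfl | hu
              · exact hvx rfl
              · rcases hv with rfl | hv
                · exact huy rfl
                · exact tri _ _ _ hxy hv hu
            simp only [huS, huy, hvx, hvT', if_false]; linarith

end

end

/-! ### From Ricci-flatness to local flatness -/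

section

variable {V : Type*} {G : SimpleGraph V} [G.LocallyFinite]

theorem exists_of_degree_eq_two [DecidableEq V] {x y : V} (hxy : G.Adj x y)
    (hx : G.degree x = 2) : ∃ u, G.Adj x u ∧ u ≠ y ∧ G.neighborFinset x = {y, u} := by
  have h : ((G.neighborFinset x).erase y).card = 1 := by
    rw [Finset.card_erase_of_mem (by simpa using hxy), SimpleGraph.card_neighborFinset_eq_degree, hx]
  obtain ⟨u, hu⟩ := Finset.card_eq_one.1 h
  have hu' : u ∈ (G.neighborFinset x).erase y := by rw [hu]; simp
  rw [Finset.mem_erase, SimpleGraph.mem_neighborFinset] at hu'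
  refine ⟨u, hu'.2, hu'.1, ?_⟩
  rw [← Finset.insert_erase (show y ∈ G.neighborFinset x by simpa using hxy), hu]

theorem exists_of_degree_eq_three [DecidableEq V] {x y : V} (hxy : G.Adj x y)
    (hx : G.degree x = 3) : ∃ u v, G.Adj x u ∧ u ≠ y ∧ G.Adj x v ∧ v ≠ y ∧ u ≠ v ∧
      G.neighborFinset x = {y, u, v} := by
  have h : ((G.neighborFinset x).erase y).card = 2 := by
    rw [Finset.card_erase_of_mem (by simpa using hxy), SimpleGraph.card_neighborFinset_eq_degree, hx]
  obtain ⟨u, v, huv, he⟩ := Finset.card_eq_two.1 h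
  have hu : u ∈ (G.neighborFinset x).erase y := by rw [he]; simp
  have hv : v ∈ (G.neighborFinset x).erase y := by rw [he]; simp
  rw [Finset.mem_erase, SimpleGraph.mem_neighborFinset] at hu hv
  refine ⟨u, v, hu.2, hu.1, hv.2, hv.1, huv, ?_⟩
  rw [← Finset.insert_erase (show y ∈ G.neighborFinset x by simpa using hxy), he]

/-- At a leaf `x` the curvature would be at least $2/d_y$. The plan leaves $\varepsilon/d_y$ at each
of `x` and `y`, sends $\varepsilon/d_y$ from `y` to each other neighbour, and moves the rest of the
mass of `x` to `y`, at total cost $1-2\varepsilon/d_y$. -/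
theorem degree_ne_one_of_curvature {x y : V} (hxy : G.Adj x y)
    (h : HasRicciCurvature G x y 0) : G.degree x ≠ 1 := by
  classical
  intro hx
  have hy : 1 ≤ G.degree y := (G.degree_pos_iff_exists_adj y).2 ⟨x, hxy.symm⟩
  have hb : (1 : ℝ) ≤ G.degree y := by exact_mod_cast hy
  have hN : G.neighborFinset x = {y} := by
    obtain ⟨z, hz⟩ := Finset.card_eq_one.1 ((G.card_neighborFinset_eq_degree x).trans hx)
    have : y ∈ G.neighborFinset x := by simpa using hxy
    rw [hz, Finset.mem_singleton] at this
    rw [hz, this]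
  have key := nonpos_of_canMove (K := 2 / G.degree y) hxy h fun ε h0 h1 => ?_
  · have : 0 < 2 / (G.degree y : ℝ) := by positivity
    linarith
  obtain ⟨b, hbdef⟩ : ∃ b : ℝ, b = G.degree y := ⟨_, rfl⟩
  rw [← hbdef] at hb ⊢
  have hε : ε / b ≤ ε := div_le_self h0.le hb
  have hε0 : 0 ≤ ε / b := by positivity
  have hcard : (((G.neighborFinset y).erase x).card : ℝ) = b - 1 := by
    rw [Finset.card_erase_of_mem (by simpa using hxy.symm),
      SimpleGraph.card_neighborFinset_eq_degree, hbdef, Nat.cast_sub hy, Nat.cast_one]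
  have dxy : (G.dist x y : ℝ) ≤ 1 := by rw [SimpleGraph.dist_eq_one_iff_adj.2 hxy]; simp
  have m := (((canMove_single (G := G) (u := x) (v := y) (a := 1 - ε - ε / b) (by linarith) dxy).add
    (canMove_single (u := x) (v := x) (a := ε / b) (c := 0) hε0 (by simp))).add
    (canMove_single (u := y) (v := y) (a := ε / b) (c := 0) hε0 (by simp))).add
    (canMove_sum ((G.neighborFinset y).erase x) (μ := fun _ => Finsupp.single y (ε / b))
      (ν := fun v => Finsupp.single v (ε / b)) (c := fun _ => ε / b * 1) fun v hv =>
        canMove_single hε0 (by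
          rw [Finset.mem_erase, SimpleGraph.mem_neighborFinset] at hv
          rw [SimpleGraph.dist_eq_one_iff_adj.2 hv.2]; simp))
  have hb0 : b ≠ 0 := by positivity
  convert m using 1
  · rw [lazyWalk, hN, hx, Finset.sum_singleton, Finset.sum_const, ← Finsupp.single_add, add_assoc,
      ← Nat.cast_smul_eq_nsmul ℝ, hcard, Finsupp.smul_single, ← Finsupp.single_add]
    congr 2
    · ring
    · rw [smul_eq_mul]; field_simp; push_cast; ring
  · rw [lazyWalk, ← Finset.add_sum_erase _ _ (show x ∈ G.neighborFinset y by simpa using hxy.symm),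
      ← hbdef, sub_sub_cancel, ← add_assoc]
    congr 1
    rw [add_right_comm, ← Finsupp.single_add, sub_add_cancel]
  · rw [Finset.sum_const, ← Nat.cast_smul_eq_nsmul ℝ, hcard, smul_eq_mul]
    field_simp
    ring

/-- If `u` and `v` are at distance at most 2, moving $\varepsilon/2$ from `u` to `v` and
$1-3\varepsilon/2$ from `x` to `y` costs at most $1-\varepsilon/2$, so the curvature is positive. -/
theorem apart_of_curvature_two_two {x y u v : V} (hxy : G.Adj x y)
    (h : HasRicciCurvature G x y 0) [DecidableEq V] (hx : G.neighborFinset x = {y, u})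
    (huy : u ≠ y) (hy : G.neighborFinset y = {x, v}) (hvx : v ≠ x)
    (huv : ∃ z, G.Adj u z ∧ G.Adj v z) : False := by
  have key := nonpos_of_canMove (K := 1 / 2) hxy h fun ε h0 h1 => ?_
  · norm_num at key
  have dxy : (G.dist x y : ℝ) ≤ 1 := by rw [SimpleGraph.dist_eq_one_iff_adj.2 hxy]; simp
  have duv : (G.dist u v : ℝ) ≤ 2 := by exact_mod_cast dist_le_two huv
  have m := (((canMove_single (G := G) (u := x) (v := y) (a := 1 - ε - ε / 2) (by linarith) dxy).add
    (canMove_single (u := x) (v := x) (a := ε / 2) (c := 0) (by linarith) (by simp))).add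
    (canMove_single (u := y) (v := y) (a := ε / 2) (c := 0) (by linarith) (by simp))).add
    (canMove_single (u := u) (v := v) (a := ε / 2) (by linarith) duv)
  convert m using 1
  · rw [lazyWalk, ← SimpleGraph.card_neighborFinset_eq_degree, hx,
      Finset.sum_pair huy.symm, Finset.card_pair huy.symm]
    ext z
    simp only [Finsupp.add_apply, Finsupp.single_apply, sub_sub_cancel, Nat.cast_ofNat]
    split_ifs <;> ring
  · rw [lazyWalk, ← SimpleGraph.card_neighborFinset_eq_degree, hy,
      Finset.sum_pair hvx.symm, Finset.card_pair hvx.symm]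
    ext z
    simp only [Finsupp.add_apply, Finsupp.single_apply, sub_sub_cancel, Nat.cast_ofNat]
    split_ifs <;> ring
  · ring

theorem apart_of_curvature_two_three {x y u v w : V} (hxy : G.Adj x y)
    (h : HasRicciCurvature G x y 0) [DecidableEq V] (hx : G.neighborFinset x = {y, u})
    (huy : u ≠ y) (hy : G.neighborFinset y = {x, v, w}) (hvx : v ≠ x) (hwx : w ≠ x) (hvw : v ≠ w)
    (huv : ∃ z, G.Adj u z ∧ G.Adj v z) (huw : ∃ z, G.Adj u z ∧ G.Adj w z) : False := by
  have key := nonpos_of_canMove (K := 1 / 6) hxy h fun ε h0 h1 => ?_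
  · norm_num at key
  have adj : ∀ z ∈ ({x, v, w} : Finset V), (G.dist y z : ℝ) ≤ 1 := fun z hz => by
    rw [← hy, SimpleGraph.mem_neighborFinset] at hz
    rw [SimpleGraph.dist_eq_one_iff_adj.2 hz]; simp
  have dxy : (G.dist x y : ℝ) ≤ 1 := by rw [SimpleGraph.dist_eq_one_iff_adj.2 hxy]; simp
  have duv : (G.dist u v : ℝ) ≤ 2 := by exact_mod_cast dist_le_two huv
  have duw : (G.dist u w : ℝ) ≤ 2 := by exact_mod_cast dist_le_two huw
  -- Each of `v`, `w` needs $\varepsilon/3$: it gets $\varepsilon/4$ from `u`, at distance at most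
  -- 2, and $\varepsilon/12$ from the surplus $\varepsilon/2-\varepsilon/3$ at `y`. The total cost
  -- is at most $1-\varepsilon/6$.
  have m := (((((((canMove_single (G := G) (u := x) (v := y) (a := 1 - ε - ε / 3) (by linarith)
    dxy).add
    (canMove_single (u := x) (v := x) (a := ε / 3) (c := 0) (by linarith) (by simp))).add
    (canMove_single (u := y) (v := y) (a := ε / 3) (c := 0) (by linarith) (by simp))).add
    (canMove_single (u := y) (v := v) (a := ε / 12) (by linarith) (adj v (by simp)))).add
    (canMove_single (u := y) (v := w) (a := ε / 12) (by linarith) (adj w (by simp)))).add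
    (canMove_single (u := u) (v := v) (a := ε / 4) (by linarith) duv)).add
    (canMove_single (u := u) (v := w) (a := ε / 4) (by linarith) duw))
  have hx' : x ∉ ({v, w} : Finset V) := by simp [hvx.symm, hwx.symm]
  convert m using 1
  · rw [lazyWalk, ← SimpleGraph.card_neighborFinset_eq_degree, hx,
      Finset.sum_pair huy.symm, Finset.card_pair huy.symm]
    ext z
    simp only [Finsupp.add_apply, Finsupp.single_apply, sub_sub_cancel, Nat.cast_ofNat]
    split_ifs <;> ring
  · rw [lazyWalk, ← SimpleGraph.card_neighborFinset_eq_degree, hy, Finset.sum_insert hx',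
      Finset.sum_pair hvw, Finset.card_insert_of_notMem hx', Finset.card_pair hvw]
    ext z
    simp only [Finsupp.add_apply, Finsupp.single_apply, sub_sub_cancel]
    push_cast
    split_ifs <;> ring
  · ring

theorem IsRicciFlat.isLocallyFlat [Nontrivial V] (hflat : IsRicciFlat G) (hG : G.Connected)
    (hg : 5 ≤ G.egirth) : IsLocallyFlat G := by
  classical
  have two : ∀ x, 2 ≤ G.degree x := by
    intro x
    have hpos : 0 < G.degree x := hG.preconnected.degree_pos_of_nontrivial x
    obtain ⟨y, hy⟩ := (G.degree_pos_iff_exists_adj x).1 hpos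
    have := degree_ne_one_of_curvature hy (hflat x y hy)
    omega
  have pos : ∀ x, (0 : ℝ) < G.degree x := fun x => by
    have := two x
    exact_mod_cast (by omega : 0 < G.degree x)
  refine ⟨not_triangle_of_egirth hg, not_square_of_egirth hg, ?_, ?_, two, ?_⟩
  · intro x y hxy
    -- With `S` empty and `T` all other neighbours of `y`, the bound reads $0\le1/d_x+(2-d_y)/d_y$.
    have hc := curvature_bound hG hg hxy (hflat x y hxy) (S := ∅)
      (T := (G.neighborFinset y).erase x) (by simp) (fun v hv => by
        rw [Finset.mem_erase, SimpleGraph.mem_neighborFinset] at hv; exact hv.symm) (by simp)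
    rw [Finset.card_erase_of_mem (by simpa using hxy.symm),
      SimpleGraph.card_neighborFinset_eq_degree, Nat.cast_sub (by have := two y; omega),
      Finset.card_empty, div_add_div _ _ (pos x).ne' (pos y).ne',
      le_div_iff₀ (mul_pos (pos x) (pos y))] at hc
    push_cast at hc
    have : (G.degree x : ℝ) * G.degree y ≤ 2 * G.degree x + G.degree y := by linarith
    exact_mod_cast this
  · intro x y u v w hxy hu huy hv hvx hw hwx hvw
    by_contra hc
    rw [not_or] at hc
    -- With one vertex in `S` and two in `T` the bound is $0-1/d_y<0$.
    have hb := curvature_bound hG hg hxy (hflat x y hxy) (S := {u}) (T := {v, w})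
      (by simp [hu, huy]) (by
        intro a ha
        rw [Finset.mem_insert, Finset.mem_singleton] at ha
        rcases ha with rfl | rfl
        · exact ⟨hv, hvx⟩
        · exact ⟨hw, hwx⟩) (by
        intro a ha b hb
        rw [Finset.mem_singleton] at ha
        rw [Finset.mem_insert, Finset.mem_singleton] at hb
        subst ha
        rcases hb with rfl | rfl
        · exact hc.1
        · exact hc.2)
    rw [Finset.card_singleton, Finset.card_pair hvw] at hb
    norm_num at hb
    have := pos y
    exact absurd hb (not_le.2 (div_neg_of_neg_of_pos (by norm_num) this))
  · intro x y hxy hx hy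
    obtain ⟨u, hu, huy, hNx⟩ := exists_of_degree_eq_two hxy hx
    by_contra hc
    push Not at hc
    have hc' : ∀ v, G.Adj y v → v ≠ x → ∃ z, G.Adj u z ∧ G.Adj v z := fun v hv hvx =>
      hc u v hu huy hv hvx
    have := two y
    rcases (by omega : G.degree y = 2 ∨ G.degree y = 3) with hy | hy
    · obtain ⟨v, hv, hvx, hNy⟩ := exists_of_degree_eq_two hxy.symm hy
      exact apart_of_curvature_two_two hxy (hflat x y hxy) hNx huy hNy hvx (hc' v hv hvx)
    · obtain ⟨v, w, hv, hvx, hw, hwx, hvw, hNy⟩ := exists_of_degree_eq_three hxy.symm hy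
      exact apart_of_curvature_two_three hxy (hflat x y hxy) hNx huy hNy hvx hwx hvw
        (hc' v hv hvx) (hc' w hw hwx)

end

/-! ### Two-regular graphs -/

section

variable {V : Type*} {G : SimpleGraph V} [G.LocallyFinite]

/-- Walking on without turning back permutes the darts; its inverse is the same walk conjugated by
reversal. The orbit of a dart under integer powers is the line, and since a dart determines its
orbit, two consecutive coincidences give a period. -/
theorem exists_line (hdeg : ∀ v, G.degree v = 2) {a b : V} (hab : G.Adj a b) :
    ∃ p : ℤ → V, (∀ i, G.Adj (p i) (p (i + 1))) ∧ (∀ i, p (i + 2) ≠ p i) ∧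
      (∀ i v, G.Adj (p i) v → v = p (i - 1) ∨ v = p (i + 1)) ∧
      ∀ i n, p i = p (i + n) → p (i + 1) = p (i + n + 1) → ∀ m, p (m + n) = p m := by
  classical
  have hex : ∀ d : G.Dart, ∃ z, G.Adj d.snd z ∧ z ≠ d.fst ∧
      ∀ v, G.Adj d.snd v → v = d.fst ∨ v = z := by
    intro d
    obtain ⟨z, hz, hzd, hN⟩ := exists_of_degree_eq_two d.adj.symm (hdeg d.snd)
    refine ⟨z, hz, hzd, fun v hv => ?_⟩
    rw [← SimpleGraph.mem_neighborFinset, hN] at hv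
    simpa using hv
  choose f hf hfne hfun using hex
  let next : G.Dart → G.Dart := fun d => ⟨(d.snd, f d), hf d⟩
  have hnext : ∀ d, (next (next d).symm).symm = d := by
    intro d
    have h1 := hfun d _ (hf (next d).symm)
    have h2 : f (next d).symm ≠ f d := hfne (next d).symm
    have h3 : f (next d).symm = d.fst := h1.resolve_right h2
    exact SimpleGraph.Dart.ext _ _ (Prod.ext h3 rfl)
  let σ : Equiv.Perm G.Dart :=
    { toFun := next
      invFun := fun d => (next d.symm).symm
      left_inv := hnext
      right_inv := fun d => by
        have := hnext d.symm
        exact SimpleGraph.Dart.symm_involutive.injective this }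
  let d₀ : G.Dart := ⟨(a, b), hab⟩
  have hsucc : ∀ i : ℤ, (σ ^ (i + 1)) d₀ = σ ((σ ^ i) d₀) := fun i => by
    rw [add_comm, zpow_one_add, Equiv.Perm.mul_apply]
  have hsnd : ∀ i : ℤ, ((σ ^ i) d₀).snd = ((σ ^ (i + 1)) d₀).fst := fun i => by
    rw [hsucc]; rfl
  refine ⟨fun i => ((σ ^ i) d₀).fst, fun i => ?_, fun i => ?_, fun i v hv => ?_,
    fun i n h1 h2 m => ?_⟩
  · dsimp only; rw [← hsnd]; exact ((σ ^ i) d₀).adj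
  · dsimp only
    rw [show i + 2 = i + 1 + 1 by ring, ← hsnd, hsucc]
    exact hfne ((σ ^ i) d₀)
  · obtain ⟨j, rfl⟩ : ∃ j, i = j + 1 := ⟨i - 1, by ring⟩
    dsimp only at hv ⊢
    rw [← hsnd] at hv
    rw [add_sub_cancel_right, ← hsnd (j + 1), hsucc]
    exact hfun _ _ hv
  · dsimp only at h1 h2 ⊢
    rw [← hsnd, ← hsnd] at h2
    have h : (σ ^ i) d₀ = (σ ^ (i + n)) d₀ := SimpleGraph.Dart.ext _ _ (Prod.ext h1 h2)
    rw [zpow_add, Equiv.Perm.mul_apply] at h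
    rw [zpow_add, Equiv.Perm.mul_apply, ← (σ ^ i).injective h]

theorem nonempty_iso_of_two_regular (hG : G.Connected) (hflat : IsLocallyFlat G)
    (hdeg : ∀ v, G.degree v = 2) {a b : V} (hab : G.Adj a b) :
    Nonempty (G ≃g infinitePath) ∨ ∃ n : ℕ, 6 ≤ n ∧ Nonempty (G ≃g SimpleGraph.cycleGraph n) := by
  classical
  obtain ⟨p, hadj, hne, hnbr, hper⟩ := exists_line hdeg hab
  have hadj' : ∀ i, G.Adj (p i) (p (i - 1)) := fun i => by
    have := (hadj (i - 1)).symm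
    rwa [sub_add_cancel] at this
  have hsurj : ∀ v, ∃ i, p i = v := by
    intro v
    obtain ⟨w⟩ := hG.preconnected (p 0) v
    suffices ∀ u w (q : G.Walk u w), (∃ i, p i = u) → ∃ i, p i = w from this _ _ w ⟨0, rfl⟩
    intro u w q
    induction q with
    | nil => exact id
    | cons h _ ih =>
      rintro ⟨i, rfl⟩
      rcases hnbr i _ h with rfl | rfl
      · exact ih ⟨_, rfl⟩
      · exact ih ⟨_, rfl⟩
  by_cases hinj : Function.Injective p
  · left
    let e : ℤ ≃ V := Equiv.ofBijective p ⟨hinj, hsurj⟩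
    refine ⟨SimpleGraph.Iso.symm ⟨e, fun {i j} => ?_⟩⟩
    change G.Adj (p i) (p j) ↔ _
    rw [infinitePath, SimpleGraph.fromRel_adj]
    constructor
    · intro h
      refine ⟨fun hij => h.ne (hij ▸ rfl), ?_⟩
      rcases hnbr i _ h with h | h
      · right; have := hinj h; omega
      · left; exact hinj h
    · rintro ⟨-, rfl | rfl⟩
      · exact hadj i
      · exact (hadj j).symm
  right
  have hex : ∃ n : ℕ, 0 < n ∧ ∃ i, p i = p (i + n) := by
    simp only [Function.Injective, not_forall] at hinj
    obtain ⟨i, j, hij, hne⟩ := hinj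
    rcases lt_or_gt_of_ne hne with h | h
    · exact ⟨(j - i).toNat, by omega, i, by rw [hij]; congr 1; omega⟩
    · exact ⟨(i - j).toNat, by omega, j, by rw [← hij]; congr 1; omega⟩
  obtain ⟨n, hn, hmin⟩ : ∃ n : ℕ, (0 < n ∧ ∃ i, p i = p (i + n)) ∧
      ∀ m : ℕ, 0 < m → m < n → ∀ i, p i ≠ p (i + m) :=
    ⟨Nat.find hex, Nat.find_spec hex, fun m h0 hm i h => Nat.find_min hex hm ⟨h0, i, h⟩⟩
  obtain ⟨hn0, i₀, hi₀⟩ := hn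
  have h1 : n ≠ 1 := by
    rintro rfl
    exact (hadj i₀).ne hi₀
  have h2 : n ≠ 2 := by
    rintro rfl
    exact hne i₀ hi₀.symm
  have hperiod : ∀ m, p (m + n) = p m := by
    refine hper i₀ n hi₀ ?_
    have h := hadj i₀
    rw [hi₀] at h
    -- The neighbour `p (i₀ + 1)` of `p (i₀ + n)` lies before or after it. Before would mean a
    -- repetition at the shorter distance `n - 2`, so the line continues periodically.
    rcases hnbr _ _ h with h | h
    · refine absurd ?_ (hmin (n - 2) (by omega) (by omega) (i₀ + 1))
      rw [h]; congr 1; omega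
    · exact h
  have h3 : n ≠ 3 := by
    rintro rfl
    have h := (hadj (0 + 2)).symm
    rw [show (0 : ℤ) + 2 + 1 = 0 + (3 : ℕ) by norm_num, hperiod] at h
    exact hflat.not_triangle _ _ _ (hadj 0) (hadj (0 + 1)) h
  have h4 : n ≠ 4 := by
    rintro rfl
    have h := (hadj 3)
    rw [show (3 : ℤ) + 1 = 0 + (4 : ℕ) by norm_num, hperiod] at h
    exact hne 1 (hflat.not_square (p 0) (p 2) (p 1) (p 3) (hadj 0) (hadj 1).symm h.symm (hadj 2)
      (hne 0).symm).symm
  have h5 : n ≠ 5 := by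
    rintro rfl
    have h := hadj 4
    rw [show (4 : ℤ) + 1 = 0 + (5 : ℕ) by norm_num, hperiod] at h
    -- In a 5-cycle the outer neighbours `p 0` and `p 3` of the edge `p 1`, `p 2` share the
    -- neighbour `p 4`, against `apart`.
    obtain ⟨u, v, hu, hu', hv, hv', hm⟩ :=
      hflat.apart (p 1) (p 2) (hadj 1) (hdeg _) (by rw [hdeg]; norm_num)
    obtain rfl := (hnbr _ _ hu).resolve_right hu'
    obtain rfl := (hnbr _ _ hv).resolve_left hv'
    exact hm ⟨p 4, h.symm, hadj 3⟩
  refine ⟨n, by omega, ?_⟩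
  have hper' : ∀ (k m : ℤ), p (m + k * n) = p m := by
    intro k
    induction k with
    | zero => simp
    | succ k ih => intro m; rw [add_mul, one_mul, ← add_assoc, hperiod, ih]
    | pred k ih =>
      intro m
      rw [← hperiod, show m + (-(k : ℤ) - 1) * n + n = m + -(k : ℤ) * n by ring, ih]
  have hiff : ∀ i j : ℤ, p i = p j ↔ (n : ℤ) ∣ j - i := by
    intro i j
    constructor
    · intro h
      by_contra hd
      have hr0 := Int.emod_nonneg (j - i) (by omega : (n : ℤ) ≠ 0)
      have hr1 := Int.emod_lt_of_pos (j - i) (by omega : 0 < (n : ℤ))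
      have hr2 : (j - i) % n ≠ 0 := fun h => hd (Int.dvd_of_emod_eq_zero h)
      refine hmin ((j - i) % n).toNat (by omega) (by omega) i ?_
      rw [h, Int.toNat_of_nonneg hr0, ← hper' ((j - i) / n) (i + (j - i) % n)]
      congr 1
      have := Int.emod_add_mul_ediv (j - i) n
      linarith
    · rintro ⟨k, hk⟩
      rw [show j = i + k * n by linarith, hper']
  have hadjiff : ∀ i j : ℤ, G.Adj (p i) (p j) ↔ (n : ℤ) ∣ i - j - 1 ∨ (n : ℤ) ∣ j - i - 1 := by
    intro i j
    have e1 : (n : ℤ) ∣ i - j - 1 ↔ p j = p (i - 1) := by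
      rw [hiff, show i - j - 1 = i - 1 - j by ring]
    have e2 : (n : ℤ) ∣ j - i - 1 ↔ p j = p (i + 1) := by
      rw [eq_comm, hiff, show j - i - 1 = j - (i + 1) by ring]
    rw [e1, e2]
    constructor
    · exact hnbr i _
    · rintro (h | h) <;> rw [h]
      · exact hadj' i
      · exact hadj i
  have hfin : ∀ i j : Fin n, (i - j : Fin n).val = 1 ↔ (n : ℤ) ∣ (i : ℤ) - j - 1 := by
    intro i j
    have h1n : 1 % n = 1 := Nat.mod_eq_of_lt (by omega)
    rw [Fin.val_sub]
    conv_lhs => rw [← h1n]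
    change n - (j : ℕ) + i ≡ 1 [MOD n] ↔ _
    rw [Nat.ModEq.comm, Nat.modEq_iff_dvd]
    push_cast [Nat.cast_sub j.2.le]
    rw [show (n : ℤ) - j + i - 1 = n + (i - j - 1) by ring]
    exact dvd_add_right (dvd_refl _)
  let e : Fin n ≃ V := Equiv.ofBijective (fun i : Fin n => p (i : ℕ))
    ⟨fun i j hij => by
      have h := (hiff _ _).1 hij
      have := Int.eq_zero_of_abs_lt_dvd h (by rw [abs_lt]; constructor <;> omega)
      exact Fin.ext (by omega), fun v => by
      obtain ⟨i, rfl⟩ := hsurj v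
      have hr0 := Int.emod_nonneg i (by omega : (n : ℤ) ≠ 0)
      have hr1 := Int.emod_lt_of_pos i (by omega : 0 < (n : ℤ))
      refine ⟨⟨(i % n).toNat, by omega⟩, ?_⟩
      change p (((i % n).toNat : ℕ) : ℤ) = p i
      rw [hiff, Int.toNat_of_nonneg hr0]
      exact Int.dvd_self_sub_emod⟩
  refine ⟨SimpleGraph.Iso.symm ⟨e, fun {i j} => ?_⟩⟩
  change G.Adj (p (i : ℕ)) (p (j : ℕ)) ↔ _
  rw [SimpleGraph.cycleGraph_adj', hadjiff, hfin, hfin]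

end

section

variable {V : Type*} {G : SimpleGraph V}

/-! ### The coded graphs -/

instance : DecidableRel dodecahedralGraph.Adj := by
  unfold dodecahedralGraph; infer_instance

theorem dodecahedralGraph_adj_iff : ∀ i < (20 : ℕ), ∀ j < (20 : ℕ),
    dodecahedralGraph.Adj (Fin.ofNat 4 (i / 5), (i : ZMod 5)) (Fin.ofNat 4 (j / 5), (j : ZMod 5)) ↔
      hasBit (row dodecahedralCode i) j = true := by
  decide +kernel

instance : DecidableRel petersenGraph.Adj := by
  unfold petersenGraph; infer_instance

theorem petersenGraph_adj_iff : ∀ i < (10 : ℕ), ∀ j < (10 : ℕ),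
    petersenGraph.Adj (Fin.ofNat 2 (i / 5), (i : ZMod 5)) (Fin.ofNat 2 (j / 5), (j : ZMod 5)) ↔
      hasBit (row petersenCode i) j = true := by
  decide +kernel

instance : DecidableRel halfDodecahedralGraph.Adj := by
  unfold halfDodecahedralGraph; infer_instance

theorem halfDodecahedralGraph_adj_iff : ∀ i < (15 : ℕ), ∀ j < (15 : ℕ),
    halfDodecahedralGraph.Adj (Fin.ofNat 3 (i / 5), (i : ZMod 5))
      (Fin.ofNat 3 (j / 5), (j : ZMod 5)) ↔ hasBit (row halfDodecahedralCode i) j = true := by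
  decide +kernel

instance : DecidableRel triplexGraph.Adj := by
  unfold triplexGraph; infer_instance

theorem triplexGraph_adj_iff : ∀ i < (12 : ℕ), ∀ j < (12 : ℕ),
    triplexGraph.Adj (i : ZMod 12) (j : ZMod 12) ↔ hasBit (row triplexCode i) j = true := by
  decide +kernel

/-! ### The classification -/

/-- The picture with one unexplored vertex is coded by 0; one application of `expand` turns it into
the star. -/
theorem exists_realizes_star [G.LocallyFinite] {v : V} {d : ℕ} (hd : G.degree v = d)
    (h31 : d ≤ 31) : ∃ φ : ℕ → V, Realizes G 1 (1 + d) (link 0 0 (List.range' 1 d)) φ := by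
  have h : Realizes G 0 1 0 fun _ => v :=
    ⟨by omega, by omega, fun i hi j hj _ => by omega,
      fun i _ j _ => by simp [Linked], fun i hi => by omega⟩
  obtain ⟨-, h2⟩ := h.expand (by omega) hd (l := []) List.nodup_nil (by simp)
  obtain ⟨φ, -, hφ⟩ := h2 (by simp; omega)
  exact ⟨φ, hφ⟩

theorem exists_realizes_two_three [G.LocallyFinite] (hG : IsLocallyFlat G) {u v : V}
    (huv : G.Adj u v) (hu : G.degree u = 2) (hv : G.degree v = 3) :
    ∃ φ : ℕ → V, Realizes G 2 5 (link (link 0 0 [1, 2]) 1 [0, 3, 4]) φ := by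
  have h : Realizes G 0 2 0 fun i => if i = 0 then u else v := by
    refine ⟨by omega, by omega, fun i hi j hj h => ?_,
      fun i _ j _ => by simp [Linked], fun i hi => by omega⟩
    by_cases h1 : i = 0 <;> by_cases h2 : j = 0 <;> simp [h1, h2, huv.ne, huv.ne'] at h <;> omega
  obtain ⟨-, h2⟩ := h.expand (by omega) (d := 2) (by simpa using hu) (l := [1]) (by simp) (by
    intro j
    rw [List.mem_singleton]
    constructor
    · rintro rfl; exact ⟨by omega, by simpa using huv⟩
    · rintro ⟨h1, h2⟩
      by_contra hj
      obtain rfl : j = 0 := by omega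
      simp at h2)
  obtain ⟨φ, hφ0, hφ⟩ := h2 (by simp)
  replace hφ : Realizes G 1 3 (link 0 0 [1, 2]) φ := hφ
  have e0 : φ 0 = u := by rw [hφ0 0 (by omega)]; rfl
  have e1 : φ 1 = v := by rw [hφ0 1 (by omega)]; rfl
  obtain ⟨-, h3⟩ := hφ.expand (by omega) (d := 3) (by rw [← hv, ← e1]) (l := [0]) (by simp) (by
    intro j
    have huj : j = 2 → G.Adj u (φ j) := by
      rintro rfl
      rw [← e0]
      exact ((hφ.linked_iff 0 (by omega) 2 (by omega)).1
        ((linked_link (by omega) (by simp) (by omega)).2 (Or.inr (Or.inl ⟨rfl, by simp⟩)))).2.2.2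
    change _ ↔ j < 3 ∧ G.Adj (φ 1) (φ j)
    rw [List.mem_singleton, e1]
    constructor
    · rintro rfl; exact ⟨by omega, by rw [e0]; exact huv.symm⟩
    · rintro ⟨h1, h2⟩
      by_contra hj
      rcases (by omega : j = 1 ∨ j = 2) with h | h
      · rw [h, e1] at h2; exact G.loopless.irrefl _ h2
      · exact hG.not_triangle _ _ _ huv h2 (huj h))
  obtain ⟨φ', -, hφ'⟩ := h3 (by simp)
  exact ⟨φ', hφ'⟩

theorem exists_adj_two_three [G.LocallyFinite] (hG : G.Connected)
    (hdeg : ∀ v, G.degree v = 2 ∨ G.degree v = 3) {a b : V} (ha : G.degree a = 2)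
    (hb : G.degree b = 3) : ∃ u v, G.Adj u v ∧ G.degree u = 2 ∧ G.degree v = 3 := by
  by_contra hc
  push Not at hc
  obtain ⟨p⟩ := hG.preconnected a b
  suffices ∀ u w (p : G.Walk u w), G.degree u = 2 → G.degree w = 2 by
    have := this a b p ha
    omega
  intro u w p
  induction p with
  | nil => exact id
  | cons h _ ih => exact fun hu => ih ((hdeg _).resolve_right (hc _ _ h hu))

end

end RicciFlat

open RicciFlat

theorem theorem1 {V : Type*} [Nontrivial V] (G : SimpleGraph V) [G.LocallyFinite]
    (hconn : G.Connected) (hgirth : 5 ≤ G.egirth) (hflat : RicciFlat.IsRicciFlat G) :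
    Nonempty (G ≃g RicciFlat.infinitePath) ∨
    (∃ n : ℕ, 6 ≤ n ∧ Nonempty (G ≃g SimpleGraph.cycleGraph n)) ∨
    Nonempty (G ≃g RicciFlat.dodecahedralGraph) ∨
    Nonempty (G ≃g RicciFlat.petersenGraph) ∨
    Nonempty (G ≃g RicciFlat.halfDodecahedralGraph) ∨
    Nonempty (G ≃g RicciFlat.triplexGraph) := by
  have hG := hflat.isLocallyFlat hconn hgirth
  have hnbr : ∀ x, ∃ y, G.Adj x y := fun x =>
    (G.degree_pos_iff_exists_adj x).1 (by have := hG.two_le_degree x; omega)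
  have hdeg : ∀ v, G.degree v = 2 ∨ G.degree v = 3 ∨ G.degree v = 4 := by
    intro x
    obtain ⟨y, hxy⟩ := hnbr x
    have h1 := hG.degree_mul_le x y hxy
    have h2 := hG.degree_mul_le y x hxy.symm
    have hx := hG.two_le_degree x
    have hy := hG.two_le_degree y
    have : G.degree x ≤ 4 := by
      -- The inequality `h2` amounts to $(d_x-2)(d_y-1)\le2$, which fails for $d_x\ge5$, $d_y\ge2$.
      by_contra hc
      obtain ⟨a, ha⟩ : ∃ a, G.degree x = a + 5 := ⟨G.degree x - 5, by omega⟩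
      obtain ⟨b, hb⟩ : ∃ b, G.degree y = b + 2 := ⟨G.degree y - 2, by omega⟩
      rw [ha, hb] at h1 h2
      nlinarith
    omega
  have hdeg3 : ∀ v, G.degree v = 2 ∨ G.degree v = 3 := by
    intro v
    rcases hdeg v with h | h | h
    · exact Or.inl h
    · exact Or.inr h
    · obtain ⟨φ, hφ⟩ := exists_realizes_star h (by omega)
      obtain ⟨_, _, _, hc, -⟩ := hφ.exists_leaf hG (D := 4) (degs := [2, 3, 4])
        (fun v => by rcases hdeg v with h | h | h <;> omega) (fun v => by simpa using hdeg v)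
        explore_degree_four
      -- The leaf test is constantly `false`, so an accepted leaf is absurd.
      cases hc
  have hD : ∀ v, G.degree v ≤ 3 := fun v => by rcases hdeg3 v with h | h <;> omega
  by_cases h2 : ∀ v, G.degree v = 2
  · obtain ⟨a⟩ := hconn.nonempty
    obtain ⟨b, hab⟩ := hnbr a
    rcases nonempty_iso_of_two_regular hconn hG h2 hab with h | h
    · exact Or.inl h
    · exact Or.inr (Or.inl h)
  right; right
  by_cases h3 : ∀ v, G.degree v = 3
  · obtain ⟨a⟩ := hconn.nonempty
    obtain ⟨φ, hφ⟩ := exists_realizes_star (h3 a) (by omega)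
    obtain ⟨n, M, φ', hleaf, hr⟩ := hφ.exists_leaf hG (degs := [3]) hD (by simpa using h3)
      explore_cubic
    rw [rec_eq_cond, rec_eq_cond] at hleaf
    cases e1 : isIso 10 petersenCode n M
    · rw [e1, cond_false] at hleaf
      cases e2 : isIso 12 triplexCode n M
      · rw [e2, cond_false] at hleaf
        refine Or.inl (hr.nonempty_iso hconn (by omega) (by simp) ?_ dodecahedralGraph_adj_iff hleaf)
        decide +kernel
      · refine Or.inr (Or.inr (Or.inr (hr.nonempty_iso hconn (by omega) (by simp) ?_
          triplexGraph_adj_iff e2)))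
        decide +kernel
    · refine Or.inr (Or.inl (hr.nonempty_iso hconn (by omega) (by simp) ?_
        petersenGraph_adj_iff e1))
      decide +kernel
  · push Not at h2 h3
    obtain ⟨a, ha⟩ := h3
    obtain ⟨b, hb⟩ := h2
    obtain ⟨u, v, huv, hu, hv⟩ := exists_adj_two_three hconn hdeg3
      ((hdeg3 a).resolve_right ha) ((hdeg3 b).resolve_left hb)
    obtain ⟨φ, hφ⟩ := exists_realizes_two_three hG huv hu hv
    obtain ⟨n, M, φ', hleaf, hr⟩ := hφ.exists_leaf hG (degs := [2, 3]) hD (by simpa using hdeg3)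
      explore_mixed
    refine Or.inr (Or.inr (Or.inl (hr.nonempty_iso hconn (by omega) (by simp) ?_
      halfDodecahedralGraph_adj_iff hleaf)))
    decide +kernel
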